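/- **Definitions.** A commutative residuated lattice is an algebra $\langle A,\vee,\wedge,\cdot,\to,1\rangle$ such that $\langle A,\vee,\wedge\rangle$ is a lattice, $\langle A,\cdot,1\rangle$ is a commutative monoid, and $ab\le c\iff a\le b\to c$ for all $a,b,c\in A$; it is integral if $1$ is its largest element. Write $\mathop{\sim}x=x\to 1$. A K-lattice is a commutative residuated lattice $\mathbf A$ such that $(x\to1)\to1=x$ for all $x$, both lattice distributive laws hold whenever at least one of the three elements involved equals $1$, and $\mathbf A$ satisfies $xy\wedge 1\approx(x\wedge1)(y\wedge1)$ and $((x\wedge1)\to y)\wedge((\mathop{\sim}y\wedge1)\to\mathop{\sim}x)\approx x\to y$. For an integral commutative residuated lattice $\mathbf A$, the K-expansion $K(\mathbf A)$ has universe $A\times A$, unit $\langle 1,1\rangle$ and operations $$\langle a,b\rangle\vee\langle c,d\rangle=\langle a\vee c,b\wedge d\rangle,\qquad \langle a,b\rangle\wedge\langle c,d\rangle=\langle a\wedge c,b\vee d\rangle,$$ $$\langle a,b\rangle\langle c,d\rangle=\langle ac,(a\to d)\wedge(c\to b)\rangle,\qquad \langle a,b\rangle\to\langle c,d\rangle=\langle(a\to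 c)\wedge(d\to b),ad\rangle .$$ For a class $\mathsf V$ of integral commutative residuated lattices, $K(\mathsf V)$ is the class of all K-lattices that embed into $K(\mathbf L)$ for some $\mathbf L\in\mathsf V$. A variety is an equational class, and $\mathbf V(\mathbf A)$ is the variety generated by $\mathbf A$. Let $\Omega(\mathsf C)$ be the class of all integral commutative residuated lattices satisfying $(x\to y)\vee(y\to x)\approx1$, $x(x\to y)\approx y(y\to x)$ and $x\to x^2\approx x$. Let $\mathbf C_\omega$ be the chain $1=a^0>a>a^2>\cdots$ with $a^ra^s=a^{r+s}$ and $a^r\to a^s=a^{\max\{s-r,0\}}$. For $k\in\mathbb N=\{0,1,2,\dots\}$ let $\bigoplus_{n=0}^k\mathbf C_\omega$ be the ordinal sum of $k+1$ copies of $\mathbf C_\omega$: the copies share their unit, which is the top element, and all other elements of the $i$-th copy lie below those of the $j$-th copy if $i<j$; each copy is a subalgebra; and for $x\ne 1$ in the $i$-th and $y\neq1$ in the $j$-th copy with $i<j$ one has $xy=yx=x$, $x\to y=1$ and $y\to x=x$. Put $\mathbf K^k_\omega=K\bigl(\bigoplus_{n=0}^k\mathbf C_\omega\bigr)$. **Theorem.**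 $K(\Omega(\mathsf C))$ is a variety, and its subvarieties, ordered by inclusion, form a countable chain of order type $\omega+1$. The proper subvarieties of $K(\Omega(\mathsf C))$ other than the variety of one-element algebras are exactly the varieties $\mathbf V(\mathbf K^k_\omega)$ with $k\in\mathbb N$. -/

import Mathlib

/-! Commutative residuated lattices, K-expansions, ordinal sums, varieties. -/

universe u v

namespace KLattice

/-! ### Commutative residuated lattices -/

/-- A lattice that is a commutative monoid is a commutative residuated lattice when it has an
operation `⇨` that is residual to the product: `a * b ≤ c ↔ a ≤ b ⇨ c`. -/
class Residuated (A : Type u) [Lattice A] [CommMonoid A] extends HImp A where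
  mul_le_iff_le_himp : ∀ a b c : A, a * b ≤ c ↔ a ≤ b ⇨ c

/-- Integrality: `1` is the largest element. -/
class Integral (A : Type u) [Lattice A] [CommMonoid A] : Prop where
  le_one : ∀ a : A, a ≤ 1

/-- A (bundled) commutative residuated lattice. -/
structure CRLAlg where
  carrier : Type u
  [lattice : Lattice carrier]
  [commMonoid : CommMonoid carrier]
  [residuated : Residuated carrier]

instance : CoeSort CRLAlg.{u} (Type u) := ⟨CRLAlg.carrier⟩

attribute [instance] CRLAlg.lattice CRLAlg.commMonoid CRLAlg.residuated

/-- A (bundled) commutative and integral residuated lattice. -/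
structure CIRLAlg where
  carrier : Type u
  [lattice : Lattice carrier]
  [commMonoid : CommMonoid carrier]
  [residuated : Residuated carrier]
  [integral : Integral carrier]

instance : CoeSort CIRLAlg.{u} (Type u) := ⟨CIRLAlg.carrier⟩

attribute [instance] CIRLAlg.lattice CIRLAlg.commMonoid CIRLAlg.residuated CIRLAlg.integral

/-- Homomorphisms for the signature `∨, ∧, ·, →, 1`. -/
structure IsHom {A : Type u} {B : Type v} [Lattice A] [CommMonoid A] [Residuated A]
    [Lattice B] [CommMonoid B] [Residuated B] (f : A → B) : Prop where
  map_sup : ∀ x y, f (x ⊔ y) = f x ⊔ f y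
  map_inf : ∀ x y, f (x ⊓ y) = f x ⊓ f y
  map_mul : ∀ x y, f (x * y) = f x * f y
  map_himp : ∀ x y, f (x ⇨ y) = f x ⇨ f y
  map_one : f 1 = 1

/-! ### Terms, equations, varieties -/

/-- Terms in the signature `∨, ∧, ·, →, 1` over countably many variables. -/
inductive RLTerm : Type
  | var : ℕ → RLTerm
  | one : RLTerm
  | sup : RLTerm → RLTerm → RLTerm
  | inf : RLTerm → RLTerm → RLTerm
  | mul : RLTerm → RLTerm → RLTerm
  | imp : RLTerm → RLTerm → RLTerm

/-- Value of a term under an assignment of the variables. -/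
def RLTerm.eval {A : Type u} [Lattice A] [CommMonoid A] [Residuated A] (x : ℕ → A) :
    RLTerm → A
  | .var n => x n
  | .one => 1
  | .sup s t => s.eval x ⊔ t.eval x
  | .inf s t => s.eval x ⊓ t.eval x
  | .mul s t => s.eval x * t.eval x
  | .imp s t => s.eval x ⇨ t.eval x

/-- The algebra `A` satisfies the equation `e.1 ≈ e.2`. -/
def Satisfies (A : CRLAlg.{u}) (e : RLTerm × RLTerm) : Prop :=
  ∀ x : ℕ → A, e.1.eval x = e.2.eval x

/-- A variety of commutative residuated lattices: an equational class. -/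
def IsVariety (W : Set CRLAlg.{u}) : Prop :=
  ∃ E : Set (RLTerm × RLTerm), W = {A | ∀ e ∈ E, Satisfies A e}

/-- The variety generated by a class `𝒦`: all algebras satisfying every equation that is
valid in `𝒦`. It is the smallest variety containing `𝒦`, see `subset_varietyGen`,
`isVariety_varietyGen`, `varietyGen_subset`. -/
def varietyGen (𝒦 : Set CRLAlg.{v}) : Set CRLAlg.{u} :=
  {A | ∀ e : RLTerm × RLTerm, (∀ B ∈ 𝒦, Satisfies B e) → Satisfies A e}

theorem isVariety_varietyGen (𝒦 : Set CRLAlg.{v}) : IsVariety (varietyGen.{u, v} 𝒦) :=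
  ⟨{e | ∀ B ∈ 𝒦, Satisfies B e}, rfl⟩

theorem subset_varietyGen (𝒦 : Set CRLAlg.{u}) : 𝒦 ⊆ varietyGen.{u, u} 𝒦 :=
  fun A hA _ he => he A hA

theorem varietyGen_subset {𝒦 W : Set CRLAlg.{u}} (hW : IsVariety W) (h : 𝒦 ⊆ W) :
    varietyGen.{u, u} 𝒦 ⊆ W := by
  obtain ⟨E, rfl⟩ := hW
  exact fun A hA e he => hA e fun B hB => h hB e he

/-- The lattice of subvarieties of `V`, ordered by inclusion. -/
abbrev Subvariety (V : Set CRLAlg.{u}) : Type (u + 1) :=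
  {W : Set CRLAlg.{u} // IsVariety W ∧ W ⊆ V}

/-! ### K-lattices and the K-expansion -/

/-- `1`-involutivity, where `∼x = x → 1`. -/
def OneInvolutive (A : CRLAlg.{u}) : Prop :=
  ∀ x : A, (x ⇨ 1) ⇨ 1 = x

/-- Both lattice distributive laws hold whenever one of the three elements is `1`. -/
def OneDistributive (A : CRLAlg.{u}) : Prop :=
  ∀ x y z : A, (x = 1 ∨ y = 1 ∨ z = 1) →
    x ⊓ (y ⊔ z) = (x ⊓ y) ⊔ (x ⊓ z) ∧ x ⊔ (y ⊓ z) = (x ⊔ y) ⊓ (x ⊔ z)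

/-- The class of K-lattices. -/
def KL : Set CRLAlg.{u} :=
  {A | OneInvolutive A ∧ OneDistributive A ∧
    (∀ x y : A, (x * y) ⊓ 1 = (x ⊓ 1) * (y ⊓ 1)) ∧
    (∀ x y : A, ((x ⊓ 1) ⇨ y) ⊓ (((y ⇨ 1) ⊓ 1) ⇨ (x ⇨ 1)) = x ⇨ y)}

/-- The universe `A × A` of the K-expansion of `A`. -/
@[ext] structure KExp (A : Type u) : Type u where
  fst : A
  snd : A

namespace KExp

variable {A : Type u} [Lattice A]

instance : Lattice (KExp A) where
  le x y := x.fst ≤ y.fst ∧ y.snd ≤ x.snd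
  le_refl x := ⟨le_refl _, le_refl _⟩
  le_trans x y z h k := ⟨h.1.trans k.1, k.2.trans h.2⟩
  le_antisymm x y h k := KExp.ext (le_antisymm h.1 k.1) (le_antisymm k.2 h.2)
  sup x y := ⟨x.fst ⊔ y.fst, x.snd ⊓ y.snd⟩
  inf x y := ⟨x.fst ⊓ y.fst, x.snd ⊔ y.snd⟩
  le_sup_left x y := ⟨le_sup_left, inf_le_left⟩
  le_sup_right x y := ⟨le_sup_right, inf_le_right⟩
  sup_le x y z h k := ⟨sup_le h.1 k.1, le_inf h.2 k.2⟩
  inf_le_left x y := ⟨inf_le_left, le_sup_left⟩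
  inf_le_right x y := ⟨inf_le_right, le_sup_right⟩
  le_inf x y z h k := ⟨le_inf h.1 k.1, sup_le h.2 k.2⟩

variable [CommMonoid A] [Residuated A] [Integral A]

instance : CommMonoid (KExp A) where
  one := ⟨1, 1⟩
  mul x y := ⟨x.fst * y.fst, (x.fst ⇨ y.snd) ⊓ (y.fst ⇨ x.snd)⟩
  mul_assoc x y z := by
    refine KExp.ext (mul_assoc _ _ _) (eq_of_forall_le_iff fun w => ?_)
    change w ≤ (x.fst * y.fst ⇨ z.snd) ⊓ (z.fst ⇨ (x.fst ⇨ y.snd) ⊓ (y.fst ⇨ x.snd)) ↔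
      w ≤ (x.fst ⇨ (y.fst ⇨ z.snd) ⊓ (z.fst ⇨ y.snd)) ⊓ (y.fst * z.fst ⇨ x.snd)
    simp only [le_inf_iff, ← Residuated.mul_le_iff_le_himp]
    rw [show w * (x.fst * y.fst) = w * x.fst * y.fst from (mul_assoc _ _ _).symm,
      show w * z.fst * x.fst = w * x.fst * z.fst from mul_right_comm _ _ _,
      show w * z.fst * y.fst = w * (y.fst * z.fst) by rw [mul_assoc, mul_comm z.fst]]
    tauto
  one_mul x := by
    refine KExp.ext (one_mul _) (eq_of_forall_le_iff fun w => ?_)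
    change w ≤ (1 ⇨ x.snd) ⊓ (x.fst ⇨ 1) ↔ w ≤ x.snd
    simp [← Residuated.mul_le_iff_le_himp, Integral.le_one]
  mul_one x := by
    refine KExp.ext (mul_one _) (eq_of_forall_le_iff fun w => ?_)
    change w ≤ (x.fst ⇨ 1) ⊓ (1 ⇨ x.snd) ↔ w ≤ x.snd
    simp [← Residuated.mul_le_iff_le_himp, Integral.le_one]
  mul_comm x y := KExp.ext (mul_comm _ _) (inf_comm _ _)

instance : Residuated (KExp A) where
  himp x y := ⟨(x.fst ⇨ y.fst) ⊓ (y.snd ⇨ x.snd), x.fst * y.snd⟩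
  mul_le_iff_le_himp x y z := by
    change x.fst * y.fst ≤ z.fst ∧ z.snd ≤ (x.fst ⇨ y.snd) ⊓ (y.fst ⇨ x.snd) ↔
      x.fst ≤ (y.fst ⇨ z.fst) ⊓ (z.snd ⇨ y.snd) ∧ y.fst * z.snd ≤ x.snd
    simp only [le_inf_iff, ← Residuated.mul_le_iff_le_himp]
    rw [mul_comm z.snd x.fst, mul_comm z.snd y.fst]
    tauto

end KExp

/-- For a class `V` of integral commutative residuated lattices, `K(V)` is the class of
K-lattices that embed into the K-expansion of a member of `V`. -/
def KClass (V : Set CIRLAlg.{u}) : Set CRLAlg.{u} :=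
  {A | A ∈ KL ∧ ∃ L ∈ V, ∃ f : A → KExp L, Function.Injective f ∧ IsHom f}

/-! ### Basic hoops and `Ω(C)` -/

/-- Basic hoops: prelinear and divisible. -/
def BasicHoop : Set CIRLAlg.{u} :=
  {A | (∀ x y : A, (x ⇨ y) ⊔ (y ⇨ x) = 1) ∧ (∀ x y : A, x * (x ⇨ y) = y * (y ⇨ x))}

/-- The class `Ω(C)` of basic hoops satisfying `x → x² ≈ x`. -/
def OmegaC : Set CIRLAlg.{u} :=
  {A | A ∈ BasicHoop ∧ ∀ x : A, (x ⇨ x ^ 2) = x}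

/-! ### The cancellative hoop `C_ω` -/

/-- The universe of `C_ω`; `⟨r⟩` stands for the power `a ^ r` of the generator. -/
@[ext] structure COmega : Type where
  exp : ℕ

namespace COmega

/-- `1 = a⁰ > a > a² > …`. -/
instance : LinearOrder COmega :=
  LinearOrder.lift' (fun x : COmega => OrderDual.toDual x.exp)
    (fun _ _ h => COmega.ext h)

theorem le_iff {x y : COmega} : x ≤ y ↔ y.exp ≤ x.exp := Iff.rfl

instance : CommMonoid COmega where
  one := ⟨0⟩
  mul x y := ⟨x.exp + y.exp⟩
  mul_assoc _ _ _ := COmega.ext (Nat.add_assoc _ _ _)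
  one_mul _ := COmega.ext (Nat.zero_add _)
  mul_one _ := COmega.ext (Nat.add_zero _)
  mul_comm _ _ := COmega.ext (Nat.add_comm _ _)

/-- The subtraction of natural numbers is truncated: `a ^ r → a ^ s = a ^ max (s - r) 0`. -/
instance : Residuated COmega where
  himp x y := ⟨y.exp - x.exp⟩
  mul_le_iff_le_himp x y z := by
    change z.exp ≤ x.exp + y.exp ↔ z.exp - y.exp ≤ x.exp
    omega

instance : Integral COmega where
  le_one x := Nat.zero_le x.exp

end COmega

/-! ### Ordinal sums of copies of a chain -/

/-- The universe of the ordinal sum `⨁_{i ∈ I} A` of copies of the chain `A` indexed by the chain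
`I`: a common unit together with a copy of `A \ {1}` for each `i : I`. -/
inductive OrdSum (I : Type u) (A : Type v) [LT A] [One A] : Type (max u v)
  | unit : OrdSum I A
  | el (i : I) (a : A) (h : a < 1) : OrdSum I A

namespace OrdSum

variable {I : Type u} {A : Type v}

/-- The position of an element: the unit is on top, the other elements are ordered first by their
index and then inside `A`. -/
def pos [LT A] [One A] : OrdSum I A → WithTop (I ×ₗ A)
  | unit => ⊤
  | el i a _ => ((toLex (i, a) : I ×ₗ A) : WithTop (I ×ₗ A))

theorem pos_injective [LT A] [One A] : Function.Injective (pos : OrdSum I A → _) := by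
  intro x y h
  cases x <;> cases y <;> simp_all [pos]

noncomputable instance [LinearOrder I] [LinearOrder A] [One A] : LinearOrder (OrdSum I A) :=
  LinearOrder.lift' pos pos_injective

theorem le_unit [LinearOrder I] [LinearOrder A] [One A] (x : OrdSum I A) : x ≤ unit :=
  le_top (α := WithTop (I ×ₗ A))

theorem not_unit_le_el [LinearOrder I] [LinearOrder A] [One A] (i : I) (a : A) (h : a < 1) :
    ¬ unit ≤ el i a h := fun hle =>
  WithTop.coe_ne_top (α := I ×ₗ A) (top_le_iff.1 hle)

theorem el_le_el [LinearOrder I] [LinearOrder A] [One A] {i j : I} {a b : A}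
    {ha : a < 1} {hb : b < 1} : el i a ha ≤ el j b hb ↔ i < j ∨ i = j ∧ a ≤ b :=
  (WithTop.coe_le_coe (α := I ×ₗ A)).trans Prod.Lex.toLex_le_toLex

/-- The embedding of `A` as the summand of index `i`, mapping `1` to the common unit. -/
def emb [LinearOrder A] [One A] (i : I) (a : A) : OrdSum I A :=
  if h : a < 1 then el i a h else unit

theorem emb_lt [LinearOrder A] [One A] (i : I) {a : A} (h : a < 1) : emb i a = el i a h :=
  dif_pos h

theorem emb_one [LinearOrder A] [One A] (i : I) : emb i (1 : A) = unit :=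
  dif_neg (lt_irrefl _)

/-- The product: inside one summand it is the product of `A`, otherwise the minimum. -/
def mul [LinearOrder I] [LinearOrder A] [CommMonoid A] : OrdSum I A → OrdSum I A → OrdSum I A
  | unit, y => y
  | el i a h, unit => el i a h
  | el i a h, el j b k =>
    if i < j then el i a h else if j < i then el j b k else emb i (a * b)

theorem mul_unit [LinearOrder I] [LinearOrder A] [CommMonoid A] (x : OrdSum I A) :
    mul x unit = x := by
  cases x <;> rfl

/-- The residual: inside one summand it is the residual of `A`; for elements different from the
unit in distinct summands, `x → y` is the unit if `x` lies in the lower one, and `y` otherwise. -/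
def imp [LinearOrder I] [LinearOrder A] [CommMonoid A] [Residuated A] :
    OrdSum I A → OrdSum I A → OrdSum I A
  | unit, y => y
  | el _ _ _, unit => unit
  | el i a _, el j b k =>
    if i < j then unit else if j < i then el j b k else emb i (a ⇨ b)

variable [LinearOrder I] [LinearOrder A] [CommMonoid A] [Residuated A] [Integral A]

theorem mul_lt_one {a b : A} (h : a < 1) : a * b < 1 := by
  refine lt_of_le_of_lt ?_ h
  rw [Residuated.mul_le_iff_le_himp]
  have : b * a ≤ a := by
    rw [Residuated.mul_le_iff_le_himp]
    exact (Integral.le_one b).trans ((Residuated.mul_le_iff_le_himp _ _ _).1 (one_mul a).le)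
  exact (Residuated.mul_le_iff_le_himp _ _ _).1 (mul_comm b a ▸ this)

theorem mul_el_el (i j : I) (a b : A) (h : a < 1) (k : b < 1) :
    mul (el i a h) (el j b k) =
      if i < j then el i a h else if j < i then el j b k else el i (a * b) (mul_lt_one h) := by
  simp only [mul, emb_lt i (mul_lt_one (b := b) h)]

theorem himp_eq_one {a b : A} : a ⇨ b = 1 ↔ a ≤ b := by
  constructor
  · intro h
    have := (Residuated.mul_le_iff_le_himp 1 a b).2 h.ge
    rwa [one_mul] at this
  · intro h
    refine le_antisymm (Integral.le_one _) ((Residuated.mul_le_iff_le_himp 1 a b).1 ?_)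
    rwa [one_mul]

instance : CommMonoid (OrdSum I A) where
  one := unit
  mul := mul
  one_mul _ := rfl
  mul_one := mul_unit
  mul_comm x y := by
    change mul x y = mul y x
    rcases x with _ | ⟨i, a, h⟩ <;> rcases y with _ | ⟨j, b, k⟩ <;> try rfl
    rcases lt_trichotomy i j with hij | rfl | hij
    · simp [mul, hij, hij.not_gt]
    · simp [mul, mul_comm]
    · simp [mul, hij, hij.not_gt]
  mul_assoc x y z := by
    change mul (mul x y) z = mul x (mul y z)
    rcases x with _ | ⟨i, a, h⟩
    · rfl
    rcases y with _ | ⟨j, b, k⟩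
    · rfl
    rcases z with _ | ⟨l, c, m⟩
    · rw [mul_unit, mul_unit]
    rw [mul_el_el, mul_el_el]
    rcases lt_trichotomy i j with hij | rfl | hij
    · rcases lt_trichotomy j l with hjl | rfl | hjl
      · simp [mul_el_el, hij, hjl, hij.trans hjl]
      · simp [mul_el_el, hij]
      · simp [mul_el_el, hij, hjl, hjl.not_gt]
    · rcases lt_trichotomy i l with hjl | rfl | hjl
      · simp [mul_el_el, hjl]
      · simp [mul_el_el, mul_assoc]
      · simp [mul_el_el, hjl, hjl.not_gt]
    · rcases lt_trichotomy j l with hjl | rfl | hjl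
      · simp [mul_el_el, hij, hij.not_gt, hjl]
      · simp [mul_el_el, hij, hij.not_gt]
      · simp [mul_el_el, hij.not_gt, hjl, hjl.not_gt, hij, hjl.trans hij, (hjl.trans hij).not_gt]

theorem one_eq : (1 : OrdSum I A) = unit := rfl

instance : Integral (OrdSum I A) where
  le_one := le_unit

noncomputable instance : Residuated (OrdSum I A) where
  himp := imp
  mul_le_iff_le_himp x y z := by
    change mul x y ≤ z ↔ x ≤ imp y z
    rcases z with _ | ⟨l, c, m⟩
    · have h : imp y (unit : OrdSum I A) = unit := by cases y <;> rfl
      simp [h, le_unit]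
    rcases y with _ | ⟨j, b, k⟩
    · rw [mul_unit]
      rfl
    rcases x with _ | ⟨i, a, h⟩
    · change el j b k ≤ el l c m ↔ _
      rw [el_le_el]
      rcases lt_trichotomy j l with hjl | rfl | hjl
      · simp [imp, hjl]
      · rcases (Integral.le_one (b ⇨ c)).lt_or_eq with hbc | hbc
        · have : ¬ b ≤ c := fun hle => hbc.ne (himp_eq_one.2 hle)
          simp [imp, emb_lt _ hbc, not_unit_le_el, this]
        · simp [imp, hbc, emb_one, himp_eq_one.1 hbc]
      · simp [imp, hjl, hjl.not_gt, hjl.ne', not_unit_le_el]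
    · rw [mul_el_el]
      rcases lt_trichotomy j l with hjl | rfl | hjl
      · rcases lt_trichotomy i j with hij | rfl | hij
        · simp [imp, hjl, hij, el_le_el, le_unit, hij.trans hjl]
        · simp [imp, hjl, el_le_el, le_unit]
        · simp [imp, hjl, hij, hij.not_gt, el_le_el, le_unit]
      · rcases (Integral.le_one (b ⇨ c)).lt_or_eq with hbc | hbc
        · have hle : ¬ b ≤ c := fun hle => hbc.ne (himp_eq_one.2 hle)
          rcases lt_trichotomy i j with hij | rfl | hij
          · simp [imp, emb_lt _ hbc, el_le_el, hij]
          · simp [imp, emb_lt _ hbc, el_le_el, Residuated.mul_le_iff_le_himp]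
          · simp [imp, emb_lt _ hbc, el_le_el, hij, hij.not_gt, hij.ne', hle]
        · have hle := himp_eq_one.1 hbc
          rcases lt_trichotomy i j with hij | rfl | hij
          · simp [imp, hbc, emb_one, el_le_el, hij, le_unit]
          · simp [imp, hbc, emb_one, el_le_el, le_unit, Residuated.mul_le_iff_le_himp,
              Integral.le_one]
          · simp [imp, hbc, emb_one, el_le_el, hij, hij.not_gt, le_unit, hle]
      · rcases lt_trichotomy i j with hij | rfl | hij
        · simp [imp, hij, hjl, hjl.not_gt]
        · simp [imp, el_le_el, hjl, hjl.not_gt, hjl.ne']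
        · simp [imp, el_le_el, hij, hij.not_gt, hjl, hjl.not_gt, hjl.ne', (hjl.trans hij).not_gt,
            (hjl.trans hij).ne']

end OrdSum

/-! ### The generators -/

/-- `K_ω^k = K(⨁_{n = 0}^{k} C_ω)`, with `k + 1` summands. -/
noncomputable def KOmega (k : ℕ) : CRLAlg.{0} where
  carrier := KExp (OrdSum (Fin (k + 1)) COmega)

end KLattice

set_option linter.unusedSectionVars false

namespace KLattice

/-! A K-lattice embeds into the K-expansion of its own negative cone by x ↦ ⟨x ∧ 1, ∼x ∧ 1⟩
(`isHom_toKExp`, `toKExp_injective`), and the negative cone of K(L) is L. So membership in K(Ω(C))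
means being a K-lattice whose cone satisfies the equations of Ω(C). Relativized to the cone, these
are equations in the whole algebra, and K(Ω(C)) is a variety.

The core is `exists_KOmega_refutation`: an equation failing in A ∈ K(Ω(C)) fails in some K_ω^k lying
in V(A). A coordinate of the equation fails in the cone, hence in a chain C, the quotient of the
cone by a prime filter. In such a chain a non-unit factor can be cancelled from a product that
differs from it (`eq_of_mul_eq`). Hence the non-units split into cancellative components, and an
element of a lower component is absorbed by each element of a higher one. Finitely many elements of
a component can be given exponents in ℕ, compatibly with order and product, by a positive linear
functional on the divisible hull of the group of fractions (`exists_exponents`). The finitely many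
subterm values thus map into a finite ordinal sum of copies of C_ω, where the equation still fails.
Conversely, powers of one representative per component form a copy of this ordinal sum inside C
(`exists_embedding`). Since A maps onto all of K(C) (`map_toKExp_surjective`), the K-expansion of
that copy lies in V(A).

A subvariety is therefore generated by the K_ω^k that satisfy its equations. Their indices form an
initial segment of ℕ because K_ω^l embeds into K_ω^k for l ≤ k. Distinct segments give distinct
varieties, since `depthEq` bounds the number of components by an equation. The initial segments of
ℕ, including ℕ itself, have order type ω + 1. -/

/-! ### Positive functionals and natural exponents -/

/-- A finite set of positive elements of a linearly ordered rational vector space is positive for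
some linear functional. -/
theorem exists_functional_pos {V : Type*} [AddCommGroup V] [Module ℚ V] [LinearOrder V]
    [IsOrderedCancelAddMonoid V] [IsStrictOrderedModule ℚ V] (n : ℕ) :
    ∀ T : Finset V, T.card ≤ n → (∀ t ∈ T, 0 < t) → ∃ f : V →ₗ[ℚ] ℚ, ∀ t ∈ T, 0 < f t := by
  classical
  -- a functional that is positive on `T` and nonnegative on `t₀` can be tilted towards `t₀`
  have tilt : ∀ (T : Finset V) (t₀ : V) (f k : V →ₗ[ℚ] ℚ), (∀ t ∈ T, 0 < f t) → 0 ≤ f t₀ →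
      0 < k t₀ → ∃ g : V →ₗ[ℚ] ℚ, ∀ t ∈ insert t₀ T, 0 < g t := by
    intro T t₀ f k hf h0 hk
    have : ∃ ε : ℚ, 0 < ε ∧ ∀ t ∈ T, 0 < f t + ε * k t := by
      induction T using Finset.induction_on with
      | empty => exact ⟨1, one_pos, by simp⟩
      | insert a T _ ih =>
        obtain ⟨ε, hε, h⟩ := ih fun t ht => hf t (Finset.mem_insert_of_mem ht)
        have ha := hf a (Finset.mem_insert_self _ _)
        have hb : 0 < |k a| + 1 := by positivity
        -- The summand 1 keeps the denominator nonzero and makes the resulting bound strict: δ * |k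
        -- a| < δ * (|k a| + 1) ≤ f a.
        refine ⟨min ε (f a / (|k a| + 1)), lt_min hε (div_pos ha hb), fun t ht => ?_⟩
        have hδ : 0 < min ε (f a / (|k a| + 1)) := lt_min hε (div_pos ha hb)
        rcases Finset.mem_insert.1 ht with rfl | ht
        · have h1 : min ε (f t / (|k t| + 1)) * (|k t| + 1) ≤ f t :=
            (le_div_iff₀ hb).1 (min_le_right _ _)
          have h2 := mul_le_mul_of_nonneg_left (neg_abs_le (k t)) hδ.le
          nlinarith
        · have h1 := h t ht
          have h2 := hf t (Finset.mem_insert_of_mem ht)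
          have h3 := min_le_left ε (f a / (|k a| + 1))
          rcases le_total 0 (k t) with h4 | h4
          · have := mul_nonneg hδ.le h4
            linarith
          · have := mul_le_mul_of_nonpos_right h3 h4
            linarith
    obtain ⟨ε, hε, h⟩ := this
    refine ⟨f + ε • k, fun t ht => ?_⟩
    rcases Finset.mem_insert.1 ht with rfl | ht
    · have := mul_pos hε hk
      simpa using by linarith
    · simpa using h t ht
  induction n with
  | zero =>
    intro T hT _
    rw [Finset.card_eq_zero.1 (Nat.le_zero.1 hT)]
    exact ⟨0, by simp⟩
  | succ n ih =>
    intro T hT hpos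
    rcases T.eq_empty_or_nonempty with rfl | ⟨t₀, ht₀⟩
    · exact ⟨0, by simp⟩
    have hcard : (T.erase t₀).card ≤ n := by
      rw [Finset.card_erase_of_mem ht₀]
      omega
    rw [← Finset.insert_erase ht₀] at hpos ⊢
    generalize T.erase t₀ = T at hcard hpos ⊢
    have hp : ∀ t ∈ T, 0 < t := fun t ht => hpos t (Finset.mem_insert_of_mem ht)
    have hp₀ : 0 < t₀ := hpos t₀ (Finset.mem_insert_self _ _)
    obtain ⟨f, hf⟩ := ih T hcard hp
    rcases le_or_gt 0 (f t₀) with h0 | h0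
    · obtain ⟨k, hk⟩ := Module.Projective.exists_dual_eq_one ℚ hp₀.ne'
      exact tilt T t₀ f k hf h0 (by rw [hk]; exact one_pos)
    -- If f is negative at t₀, project along t₀ onto the kernel of f. The images of T stay positive
    -- because a positive multiple of t₀ is added, so induction gives g. Correcting g by a multiple
    -- of f yields h, which vanishes at t₀ and is positive on T. It can then be tilted by -f.
    · have key : ∃ g : V →ₗ[ℚ] ℚ, ∀ t ∈ T, 0 < g (t - (f t / f t₀) • t₀) := by
        obtain ⟨g, hg⟩ : ∃ g : V →ₗ[ℚ] ℚ, ∀ t ∈ T.image (fun t => t - (f t / f t₀) • t₀),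
            0 < g t := by
          have hpos' : ∀ t ∈ T.image (fun t => t - (f t / f t₀) • t₀), 0 < t := by
            intro t ht
            obtain ⟨s, hs, rfl⟩ := Finset.mem_image.1 ht
            have h1 : 0 < -(f s / f t₀) := neg_pos.2 (div_neg_of_pos_of_neg (hf s hs) h0)
            have h2 := add_pos (hp s hs) (smul_pos h1 hp₀)
            rwa [neg_smul, ← sub_eq_add_neg] at h2
          exact ih _ (Finset.card_image_le.trans hcard) hpos'
        exact ⟨g, fun t ht => hg _ (Finset.mem_image_of_mem _ ht)⟩
      obtain ⟨g, hg⟩ := key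
      let h : V →ₗ[ℚ] ℚ := g - (g t₀ / f t₀) • f
      refine tilt T t₀ h (-f) (fun t ht => ?_) ?_ (by simpa using h0)
      · have := hg t ht
        rw [map_sub, map_smul, smul_eq_mul] at this
        have h1 : h t = g t - f t / f t₀ * g t₀ := by
          simp only [h, LinearMap.sub_apply, LinearMap.smul_apply, smul_eq_mul]
          ring
        rwa [h1]
      · have : h t₀ = 0 := by
          simp only [h, LinearMap.sub_apply, LinearMap.smul_apply, smul_eq_mul]
          rw [div_mul_cancel₀ _ h0.ne, sub_self]
        exact this.ge

/-- Finitely many elements of a linearly ordered cancellative monoid with largest element `1` have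
exponents in `ℕ` that respect their products and their order. -/
theorem exists_exponents {M : Type*} [CommMonoid M] [LinearOrder M] [IsOrderedCancelMonoid M]
    (hM : ∀ x : M, x ≤ 1) (S : Finset M) :
    ∃ φ : M → ℕ, (∀ x ∈ S, ∀ y ∈ S, x * y ∈ S → φ (x * y) = φ x + φ y) ∧
      (∀ x ∈ S, ∀ y ∈ S, x < y → φ y < φ x) ∧ ∀ x ∈ S, x < 1 → 0 < φ x := by
  classical
  -- Cancellativity embeds M, with its order, into its group of fractions, whose divisible hull is
  -- an ordered rational vector space.
  let v : M → DivisibleHull (Additive (Localization (⊤ : Submonoid M))) :=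
    fun x => DivisibleHull.coe (Additive.ofMul (Algebra.GrothendieckGroup.of x))
  have v_mul : ∀ x y, v (x * y) = v x + v y := fun x y => by
    simp only [v, map_mul, ofMul_mul, DivisibleHull.coe_add]
  have v_one : v 1 = 0 := by
    have := v_mul 1 1
    rwa [mul_one, left_eq_add] at this
  have v_lt : ∀ x y, x < y → v x < v y := fun x y h => by
    simp only [v, DivisibleHull.coe, DivisibleHull.mk_lt_mk]
    simpa [Localization.mk_one_eq_monoidOf_mk] using
      (Localization.mkOrderEmbedding (1 : (⊤ : Submonoid M))).strictMono h
  -- Positivity on all differences makes f strictly increasing on S. Including 1 makes f negative at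
  -- the elements below 1.
  let T := (((insert 1 S) ×ˢ (insert 1 S)).filter fun p : M × M => p.1 < p.2).image
    fun p => v p.2 - v p.1
  obtain ⟨f, hf⟩ := exists_functional_pos _ T le_rfl (by
    intro t ht
    simp only [T, Finset.mem_image, Finset.mem_filter] at ht
    obtain ⟨p, ⟨_, hp⟩, rfl⟩ := ht
    exact sub_pos.2 (v_lt _ _ hp))
  have f_lt : ∀ x ∈ insert 1 S, ∀ y ∈ insert 1 S, x < y → f (v x) < f (v y) := by
    intro x hx y hy hxy
    have := hf (v y - v x) (Finset.mem_image.2 ⟨(x, y), by simp_all, rfl⟩)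
    rwa [map_sub, sub_pos] at this
  have f_nonpos : ∀ x ∈ S, f (v x) ≤ 0 := by
    intro x hx
    rcases (hM x).lt_or_eq with h | rfl
    · have := f_lt x (Finset.mem_insert_of_mem hx) 1 (Finset.mem_insert_self _ _) h
      rw [v_one, map_zero] at this
      exact this.le
    · rw [v_one, map_zero]
  -- A common denominator: the exponent of x is -N * f (v x), with the sign reversed because larger
  -- exponents mean smaller elements.
  let N : ℕ := ∏ x ∈ S, (f (v x)).den
  have hN : (0 : ℚ) < N := by
    have : 0 < N := Finset.prod_pos fun x _ => (f (v x)).pos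
    exact_mod_cast this
  have hnat : ∀ x, ∃ n : ℕ, x ∈ S → (n : ℚ) = N * -f (v x) := by
    intro x
    by_cases hx : x ∈ S
    · obtain ⟨c, hc⟩ : (f (v x)).den ∣ N := Finset.dvd_prod_of_mem (fun x => (f (v x)).den) hx
      have h1 : (f (v x)).num ≤ 0 := Rat.num_nonpos.2 (f_nonpos x hx)
      refine ⟨c * (-(f (v x)).num).toNat, fun _ => ?_⟩
      have h2 : (((-(f (v x)).num).toNat : ℤ) : ℚ) = -((f (v x)).num : ℚ) := by
        rw [Int.toNat_of_nonneg (by omega)]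
        push_cast
        rfl
      have h3 : (f (v x)) * (f (v x)).den = (f (v x)).num := Rat.mul_den_eq_num _
      rw [hc]
      push_cast at h2 ⊢
      rw [h2, ← h3]
      ring
    · exact ⟨0, fun h => absurd h hx⟩
  choose φ hφ using hnat
  refine ⟨φ, fun x hx y hy hxy => ?_, fun x hx y hy h => ?_, fun x hx h => ?_⟩
  · have : ((φ (x * y) : ℕ) : ℚ) = ((φ x + φ y : ℕ) : ℚ) := by
      push_cast
      rw [hφ x hx, hφ y hy, hφ _ hxy, v_mul, map_add]
      ring
    exact_mod_cast this
  · have : ((φ y : ℕ) : ℚ) < φ x := by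
      rw [hφ x hx, hφ y hy]
      have := f_lt x (Finset.mem_insert_of_mem hx) y (Finset.mem_insert_of_mem hy) h
      exact mul_lt_mul_of_pos_left (neg_lt_neg this) hN
    exact_mod_cast this
  · have : (0 : ℚ) < φ x := by
      rw [hφ x hx]
      have := f_lt x (Finset.mem_insert_of_mem hx) 1 (Finset.mem_insert_self _ _) h
      rw [v_one, map_zero] at this
      exact mul_pos hN (neg_pos.2 this)
    exact_mod_cast this

/-! ### Arithmetic of residuated lattices -/

namespace Residuated

section CRL

variable {A : Type u} [Lattice A] [CommMonoid A] [Residuated A]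

theorem le_res_iff {a b c : A} : a ≤ b ⇨ c ↔ a * b ≤ c := (mul_le_iff_le_himp a b c).symm

theorem res_mul_le (a b : A) : (a ⇨ b) * a ≤ b := le_res_iff.1 le_rfl

theorem mul_res_le (a b : A) : a * (a ⇨ b) ≤ b := mul_comm a (a ⇨ b) ▸ res_mul_le a b

theorem mul_mono_left {a b : A} (h : a ≤ b) (c : A) : a * c ≤ b * c :=
  le_res_iff.1 (h.trans (le_res_iff.2 le_rfl))

theorem mul_mono_right {a b : A} (h : a ≤ b) (c : A) : c * a ≤ c * b := by
  rw [mul_comm c, mul_comm c]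
  exact mul_mono_left h c

theorem mul_mono {a b c d : A} (h : a ≤ b) (k : c ≤ d) : a * c ≤ b * d :=
  (mul_mono_left h c).trans (mul_mono_right k b)

theorem res_res (a b c : A) : a ⇨ (b ⇨ c) = (a * b) ⇨ c :=
  eq_of_forall_le_iff fun w => by simp only [le_res_iff, mul_assoc]

theorem res_left_comm (a b c : A) : a ⇨ (b ⇨ c) = b ⇨ (a ⇨ c) := by
  rw [res_res, res_res, mul_comm]

theorem one_res (a : A) : (1 : A) ⇨ a = a :=
  eq_of_forall_le_iff fun w => by simp only [le_res_iff, mul_one]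

theorem res_inf (a b c : A) : a ⇨ (b ⊓ c) = (a ⇨ b) ⊓ (a ⇨ c) :=
  eq_of_forall_le_iff fun w => by simp only [le_res_iff, le_inf_iff]

theorem mul_sup_eq (a b c : A) : a * (b ⊔ c) = a * b ⊔ a * c :=
  eq_of_forall_ge_iff fun w => by
    simp only [sup_le_iff, mul_comm a, mul_le_iff_le_himp]

theorem sup_res (a b c : A) : (a ⊔ b) ⇨ c = (a ⇨ c) ⊓ (b ⇨ c) :=
  eq_of_forall_le_iff fun w => by
    simp only [le_res_iff, le_inf_iff, mul_sup_eq, sup_le_iff]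

theorem res_mono {a b c d : A} (h : b ≤ a) (k : c ≤ d) : a ⇨ c ≤ b ⇨ d :=
  le_res_iff.2 ((mul_mono_right h _).trans ((res_mul_le a c).trans k))

theorem one_le_res {a b : A} : 1 ≤ a ⇨ b ↔ a ≤ b := by rw [le_res_iff, one_mul]

theorem le_res_res (a b : A) : a ≤ (a ⇨ b) ⇨ b := le_res_iff.2 (mul_res_le a b)

end CRL

section Integral

variable {A : Type u} [Lattice A] [CommMonoid A] [Residuated A] [Integral A]

theorem le_one (a : A) : a ≤ 1 := Integral.le_one a

theorem one_le {a : A} : 1 ≤ a ↔ a = 1 := ⟨fun h => le_antisymm (le_one a) h, fun h => h.ge⟩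

theorem res_eq_one {a b : A} : a ⇨ b = 1 ↔ a ≤ b := by rw [← one_le, one_le_res]

theorem res_self (a : A) : a ⇨ a = 1 := res_eq_one.2 le_rfl

theorem res_one (a : A) : a ⇨ 1 = 1 := res_eq_one.2 (le_one a)

theorem mul_le_left (a b : A) : a * b ≤ a := (mul_mono_right (le_one b) a).trans (mul_one a).le

theorem mul_le_right (a b : A) : a * b ≤ b := (mul_mono_left (le_one a) b).trans (one_mul b).le

theorem le_res (a b : A) : b ≤ a ⇨ b := le_res_iff.2 (mul_le_left b a)

end Integral

end Residuated

/-! ### The quasi-equational content of `Ω(C)` -/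

/-- Divisibility and `x → x² = x`. -/
class IsOmega (A : Type u) [Lattice A] [CommMonoid A] [Residuated A] : Prop where
  divisible : ∀ x y : A, x * (x ⇨ y) = y * (y ⇨ x)
  himp_sq : ∀ x : A, (x ⇨ x ^ 2) = x

namespace IsOmega

open Residuated

section Hoop

variable {A : Type u} [Lattice A] [CommMonoid A] [Residuated A] [Integral A] [IsOmega A]

theorem mul_res (x y : A) : x * (x ⇨ y) = x ⊓ y := by
  refine le_antisymm (le_inf (mul_le_left _ _) (mul_res_le x y)) ?_
  have h : x ⊓ y = (x ⊓ y) * ((x ⊓ y) ⇨ x) := by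
    rw [res_eq_one.2 inf_le_left, mul_one]
  rw [h, divisible]
  exact mul_mono_right (res_mono le_rfl inf_le_right) x

theorem mul_res_of_le {x y : A} (h : y ≤ x) : x * (x ⇨ y) = y := by
  rw [mul_res, inf_eq_right.2 h]

theorem res_mul_self (x : A) : x ⇨ x * x = x := by rw [← sq, himp_sq]

/-- If `y` absorbs `x` then it also absorbs it with respect to the residual. -/
theorem res_eq_of_mul_eq {x y : A} (h : x * y = x) : y ⇨ x = x := by
  refine le_antisymm ?_ (le_res _ _)
  have hxy : x ≤ y := h ▸ mul_le_right x y
  have h1 : y * (y ⇨ x) = x := mul_res_of_le hxy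
  have h2 : (y ⇨ x) * x = x * x := by
    calc (y ⇨ x) * x = (y ⇨ x) * (x * y) := by rw [h]
      _ = x * (y * (y ⇨ x)) := by ac_rfl
      _ = x * x := by rw [h1]
  calc y ⇨ x ≤ x ⇨ x * x := le_res_iff.2 h2.le
    _ = x := res_mul_self x

theorem eq_one_of_mul_self {x : A} (h : x * x = x) : x = 1 := by
  rw [← res_mul_self x, h, res_self]

theorem mul_eq_of_le {c d w : A} (h : c * w = c) (hd : d ≤ c) : d * w = d := by
  rw [← mul_res_of_le hd, mul_right_comm, h]

end Hoop

/-! ### Absorption and cancellation in chains -/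

section Chain

variable {C : Type u} [LinearOrder C] [CommMonoid C] [Residuated C] [Integral C] [IsOmega C]

theorem mul_eq_of_res_eq {x y : C} (hx : x ≠ 1) (h : y ⇨ x = x) : x * y = x := by
  have hxy : x ≤ y := (le_total x y).resolve_right fun hyx =>
    hx (by rw [← h, res_eq_one.2 hyx])
  conv_rhs => rw [← mul_res_of_le hxy, h, mul_comm]

/-- Absorption passes from x² to x since x = x → x²: w → x = x → (w → x²) = x → x² = x. -/
theorem mul_eq_of_sq {x w : C} (h : x * x * w = x * x) : x * w = x := by
  rcases eq_or_ne x 1 with rfl | hx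
  · simpa using h
  refine mul_eq_of_res_eq hx ?_
  conv_lhs => rw [← res_mul_self x, res_left_comm, res_eq_of_mul_eq h, res_mul_self]

/-- If `w` absorbs `x` then `w` absorbs every element that does not absorb `x`. -/
theorem mul_eq_of_not_absorbs {x y w : C} (hx : x ≠ 1) (hw : x * w = x) (hy : x * y ≠ x) :
    y * w = y := by
  -- The element (y → x) → x lies above y, is not 1, and is fixed by w → ·, so w absorbs it and
  -- everything below it.
  have hT : (y ⇨ x) ⇨ x ≠ 1 := fun h => hy (mul_eq_of_res_eq hx
    (le_antisymm (res_eq_one.1 h) (le_res _ _)))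
  have hwT : w ⇨ ((y ⇨ x) ⇨ x) = (y ⇨ x) ⇨ x := by
    rw [res_left_comm, res_eq_of_mul_eq hw]
  exact mul_eq_of_le (mul_eq_of_res_eq hT hwT) (le_res_res y x)

/-- If z < y, then w = y → z absorbs xy but not y, as yw = z. For y ≤ x it absorbs y² ≤ xy, hence y.
For x ≤ y it absorbs x² ≤ xy, hence x, hence y, because y does not absorb x. Both are
contradictions. -/
theorem le_of_mul_eq {x y z : C} (hx : x ≠ 1) (h : x * y = x * z) (hxy : x * y ≠ x) : y ≤ z := by
  by_contra! hzy
  have hz : y * (y ⇨ z) = z := mul_res_of_le hzy.le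
  have hw : x * y * (y ⇨ z) = x * y := by rw [mul_assoc, hz, h]
  have hyw : y * (y ⇨ z) ≠ y := by
    rw [hz]
    exact hzy.ne
  rcases le_total y x with hyx | hxy'
  · exact hyw (mul_eq_of_sq (mul_eq_of_le hw (mul_mono_left hyx y)))
  · exact hyw (mul_eq_of_not_absorbs hx
      (mul_eq_of_sq (mul_eq_of_le hw (mul_mono_right hxy' x))) hxy)

theorem eq_of_mul_eq {x y z : C} (hx : x ≠ 1) (h : x * y = x * z) (hxy : x * y ≠ x) : y = z :=
  le_antisymm (le_of_mul_eq hx h hxy) (le_of_mul_eq hx h.symm (h ▸ hxy))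

/-- Either y absorbs x, or x can be cancelled in x(x → xy) = xy. This is what makes every pair of
K(C) reachable from the cone in `map_toKExp_surjective`. -/
theorem res_mul_eq_or (x y : C) : x ⇨ x * y = y ∨ y ⇨ x * y = x := by
  by_cases h : x * y = x
  · right
    rw [h, res_eq_of_mul_eq h]
  · left
    rcases eq_or_ne x 1 with rfl | hx
    · rw [one_mul, one_res]
    · have h1 : x * (x ⇨ x * y) = x * y := mul_res_of_le (mul_le_left x y)
      exact eq_of_mul_eq hx h1 (by rwa [h1])

/-! ### Components of a chain -/

/-- `x` lies in a strictly lower component than `y` -/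
def Below (x y : C) : Prop := x ≠ 1 ∧ y ≠ 1 ∧ x * y = x

theorem Below.lt {x y : C} (h : Below x y) : x < y := by
  refine lt_of_le_of_ne (h.2.2 ▸ mul_le_right x y) ?_
  rintro rfl
  exact h.1 (eq_one_of_mul_self h.2.2)

theorem Below.trans {x y z : C} (h : Below x y) (k : Below y z) : Below x z :=
  ⟨h.1, k.2.1, by rw [← h.2.2, mul_assoc, k.2.2]⟩

theorem Below.irrefl (x : C) : ¬ Below x x := fun h => h.lt.ne rfl

/-- Together with transitivity and irreflexivity this makes `Below` a strict weak order on the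
non-units, so that incomparability, which is `Same`, is an equivalence there. -/
theorem Below.below_or {x z : C} (h : Below x z) {y : C} (hy : y ≠ 1) : Below x y ∨ Below y z := by
  by_cases hxy : x * y = x
  · exact Or.inl ⟨h.1, hy, hxy⟩
  · exact Or.inr ⟨hy, h.2.1, mul_eq_of_not_absorbs h.1 h.2.2 hxy⟩

/-- `x` and `y` lie in the same component -/
def Same (x y : C) : Prop := x ≠ 1 ∧ y ≠ 1 ∧ ¬ Below x y ∧ ¬ Below y x

theorem Same.symm {x y : C} (h : Same x y) : Same y x := ⟨h.2.1, h.1, h.2.2.2, h.2.2.1⟩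

theorem Same.refl {x : C} (h : x ≠ 1) : Same x x := ⟨h, h, Below.irrefl x, Below.irrefl x⟩

theorem Same.below_left {x y z : C} (h : Same x y) (k : Below y z) : Below x z :=
  (k.below_or h.1).resolve_left h.2.2.2

theorem Same.below_right {x y z : C} (h : Same x y) (k : Below z y) : Below z x :=
  (k.below_or h.1).resolve_right h.2.2.1

theorem Same.trans {x y z : C} (h : Same x y) (k : Same y z) : Same x z :=
  ⟨h.1, k.2.1, fun l => k.symm.2.2.2 (h.symm.below_left l), fun l =>
    k.2.2.2 (h.symm.below_right l)⟩

theorem same_or_below {x y : C} (hx : x ≠ 1) (hy : y ≠ 1) :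
    Same x y ∨ Below x y ∨ Below y x := by
  by_cases h : Below x y
  · exact Or.inr (Or.inl h)
  by_cases k : Below y x
  · exact Or.inr (Or.inr k)
  exact Or.inl ⟨hx, hy, h, k⟩

theorem mul_ne_one {x : C} (hx : x ≠ 1) (y : C) : x * y ≠ 1 := fun h =>
  hx (le_antisymm (le_one x) (h ▸ mul_le_left x y))

/-- If x absorbed xy, then cancelling x in x(yx) = xy would make x absorb y. If xy absorbed x, then
x ≤ xy and y would absorb x. -/
theorem Same.mul {x y z : C} (h : Same x z) (k : Same y z) : Same (x * y) z := by
  suffices Same (x * y) x from this.trans h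
  have hxy : Same x y := h.trans k.symm
  have h1 : x * y ≠ x := fun e => hxy.2.2.1 ⟨hxy.1, hxy.2.1, e⟩
  refine ⟨mul_ne_one h.1 y, h.1, fun l => ?_, fun l => h1 ?_⟩
  · have h2 : x * (y * x) = x * y := by rw [← mul_assoc, l.2.2]
    have h3 := eq_of_mul_eq h.1 h2 (h2 ▸ h1)
    exact hxy.symm.2.2.1 ⟨hxy.2.1, hxy.1, h3⟩
  · exact le_antisymm (mul_le_left x y) (l.2.2.ge.trans (mul_le_right x (x * y)))

/-- The component of `r`, together with the unit. -/
def component (r : C) : Submonoid C where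
  carrier := {x | x = 1 ∨ Same x r}
  one_mem' := Or.inl rfl
  mul_mem' {x y} hx hy := by
    rcases hx with rfl | hx
    · simpa using hy
    rcases hy with rfl | hy
    · simpa using Or.inr hx
    exact Or.inr (hx.mul hy)

theorem mul_lt_mul_of_mem {r x y z : C} (hx : x ∈ component r) (hy : y ∈ component r)
    (h : y < z) : x * y < x * z := by
  refine lt_of_le_of_ne (mul_mono_right h.le x) fun e => h.ne ?_
  rcases hx with rfl | hx
  · simpa using e
  have ne : ∀ w ∈ component r, w ≠ 1 → x * w ≠ x := fun w hw hw1 e =>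
    (hx.trans (hw.resolve_left hw1).symm).2.2.1 ⟨hx.1, hw1, e⟩
  exact eq_of_mul_eq hx.1 e (ne y hy (h.trans_le (le_one z)).ne)

instance (r : C) : IsOrderedCancelMonoid (component r) :=
  .of_mul_lt_mul_left fun x y z h =>
    (mul_lt_mul_of_mem (C := C) x.2 y.2 h : (x : C) * y < x * z)

end Chain

end IsOmega

open Residuated IsOmega

/-! ### Ordinal sums of chains in `Ω(C)` -/

/-- In a chain, divisibility has content only for y < x. -/
theorem isOmega_of_chain {C : Type u} [LinearOrder C] [CommMonoid C] [Residuated C] [Integral C]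
    (hdiv : ∀ x y : C, y < x → x * (x ⇨ y) = y) (hsq : ∀ x : C, x ⇨ x * x = x) : IsOmega C where
  himp_sq x := by rw [sq, hsq]
  divisible x y := by
    rcases lt_trichotomy x y with h | rfl | h
    · rw [hdiv y x h, res_eq_one.2 h.le, mul_one]
    · rfl
    · rw [hdiv x y h, res_eq_one.2 h.le, mul_one]

instance : IsOmega COmega :=
  isOmega_of_chain
    (fun _ _ h => COmega.ext (Nat.add_sub_of_le (COmega.le_iff.1 h.le)))
    (fun x => COmega.ext (Nat.add_sub_cancel_left (n := x.exp) (m := x.exp)))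

namespace OrdSum

variable {I : Type u} {A : Type v} [LinearOrder I] [LinearOrder A] [CommMonoid A] [Residuated A]
  [Integral A]

theorem himp_el_el (i j : I) (a b : A) (h : a < 1) (k : b < 1) :
    (el i a h ⇨ el j b k : OrdSum I A) =
      if i < j then unit else if j < i then el j b k else emb i (a ⇨ b) := rfl

theorem el_mul_el (i j : I) (a b : A) (h : a < 1) (k : b < 1) :
    (el i a h * el j b k : OrdSum I A) =
      if i < j then el i a h else if j < i then el j b k else el i (a * b) (mul_lt_one h) :=
  mul_el_el i j a b h k

theorem el_ne_one (i : I) (a : A) (h : a < 1) : (el i a h : OrdSum I A) ≠ 1 := nofun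

theorem el_lt_el {i j : I} {a b : A} {ha : a < 1} {hb : b < 1} :
    el i a ha < el j b hb ↔ i < j ∨ i = j ∧ a < b := by
  rw [lt_iff_not_ge, el_le_el, not_or, not_and, not_lt]
  constructor
  · rintro ⟨h, k⟩
    rcases h.lt_or_eq with h | rfl
    · exact Or.inl h
    · exact Or.inr ⟨rfl, not_le.1 (k rfl)⟩
  · rintro (h | ⟨rfl, h⟩)
    · exact ⟨h.le, fun e => absurd e h.ne'⟩
    · exact ⟨le_rfl, fun _ => not_le.2 h⟩

instance [IsOmega A] : IsOmega (OrdSum I A) := by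
  refine isOmega_of_chain (fun x y h => ?_) fun x => ?_
  · rcases x with _ | ⟨i, a, ha⟩
    · exact (one_mul _).trans (Residuated.one_res y)
    rcases y with _ | ⟨j, b, hb⟩
    · exact absurd (le_unit _) h.not_ge
    rcases el_lt_el.1 h with hij | ⟨rfl, hab⟩
    · rw [himp_el_el, if_neg hij.not_gt, if_pos hij, el_mul_el, if_neg hij.not_gt, if_pos hij]
    · have h1 : a ⇨ b < 1 := lt_of_le_of_ne (Integral.le_one _) fun e =>
        hab.not_ge (Residuated.res_eq_one.1 e)
      rw [himp_el_el, if_neg (lt_irrefl _), if_neg (lt_irrefl _), emb_lt _ h1, el_mul_el,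
        if_neg (lt_irrefl _), if_neg (lt_irrefl _)]
      congr 1
      exact mul_res_of_le hab.le
  · rcases x with _ | ⟨i, a, ha⟩
    · rfl
    · rw [el_mul_el, if_neg (lt_irrefl _), if_neg (lt_irrefl _), himp_el_el,
        if_neg (lt_irrefl _), if_neg (lt_irrefl _), res_mul_self, emb_lt _ ha]

end OrdSum

/-! ### Homomorphisms between chains in `Ω(C)` -/

section Hom

variable {C : Type u} {D : Type v} [LinearOrder C] [CommMonoid C] [Residuated C] [Integral C]
  [IsOmega C] [LinearOrder D] [CommMonoid D] [Residuated D] [Integral D] [IsOmega D]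

/-- A partial map between chains in `Ω(C)` that respects the order and the product also respects
the residual. -/
theorem map_res_of_map_mul {h : C → D} {S : Set C} (h_one : h 1 = 1) (one_mem : 1 ∈ S)
    (h_lt : ∀ x ∈ S, ∀ y ∈ S, x < y → h x < h y)
    (h_mul : ∀ x ∈ S, ∀ y ∈ S, x * y ∈ S → h (x * y) = h x * h y)
    {x y : C} (hx : x ∈ S) (hy : y ∈ S) (hxy : x ⇨ y ∈ S) : h (x ⇨ y) = h x ⇨ h y := by
  rcases le_or_gt x y with hle | hlt
  · have : h x ≤ h y := by
      rcases hle.lt_or_eq with hlt | rfl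
      · exact (h_lt x hx y hy hlt).le
      · exact le_rfl
    rw [res_eq_one.2 hle, h_one, res_eq_one.2 this]
  · rcases eq_or_ne x 1 with rfl | hx1
    · rw [one_res, h_one, one_res]
    · have e1 : x * (x ⇨ y) = y := mul_res_of_le hlt.le
      have e2 := h_mul x hx _ hxy (e1.symm ▸ hy)
      rw [e1] at e2
      have e3 := h_lt y hy x hx hlt
      have e4 := h_lt x hx 1 one_mem (lt_of_le_of_ne (Integral.le_one x) hx1)
      rw [h_one] at e4
      -- Both h (x → y) and h x → h y give h y when multiplied by h x, and h x can be cancelled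
      -- because h y < h x < 1.
      refine eq_of_mul_eq e4.ne ?_ (e2 ▸ e3.ne)
      rw [← e2, mul_res_of_le e3.le]

theorem isHom_of_strictMono {h : C → D} (h_one : h 1 = 1) (h_lt : StrictMono h)
    (h_mul : ∀ x y, h (x * y) = h x * h y) : IsHom h where
  map_sup := h_lt.monotone.map_sup
  map_inf := h_lt.monotone.map_inf
  map_mul := h_mul
  map_one := h_one
  map_himp _ _ := map_res_of_map_mul (S := Set.univ) h_one trivial (fun _ _ _ _ hxy => h_lt hxy)
    (fun _ _ _ _ _ => h_mul _ _) trivial trivial trivial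

theorem same_pow {x : C} (hx : x ≠ 1) : ∀ n : ℕ, n ≠ 0 → Same (x ^ n) x
  | 0, h => absurd rfl h
  | 1, _ => by simpa using Same.refl hx
  | n + 2, _ => by
    rw [pow_succ]
    exact (same_pow hx (n + 1) (Nat.succ_ne_zero n)).mul (Same.refl hx)

theorem pow_lt_pow_of_lt {x : C} (hx : x ≠ 1) {m n : ℕ} (h : m < n) : x ^ n < x ^ m := by
  refine strictAnti_nat_of_succ_lt (fun n => ?_) h
  rw [pow_succ]
  refine lt_of_le_of_ne (mul_le_left _ _) fun e => ?_
  rcases eq_or_ne n 0 with rfl | hn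
  · exact hx (by simpa using e)
  · have := same_pow hx n hn
    exact this.2.2.1 ⟨this.1, hx, e⟩

theorem COmega.exp_ne_zero {a : COmega} (h : a < 1) : a.exp ≠ 0 := fun e =>
  h.ne (COmega.ext e)

theorem COmega.lt_one {n : ℕ} (h : n ≠ 0) : (⟨n⟩ : COmega) < 1 :=
  lt_of_le_of_ne (Integral.le_one _) fun e => h (congrArg COmega.exp e)

/-- An increasing sequence of components of `C` yields a subalgebra of `C` that is an ordinal sum
of copies of `C_ω`. -/
theorem exists_embedding {I : Type v} [LinearOrder I] (c : I → C) (c_ne : ∀ i, c i ≠ 1)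
    (c_below : ∀ i j, i < j → Below (c i) (c j)) :
    ∃ g : OrdSum I COmega → C, Function.Injective g ∧ IsHom g := by
  let g : OrdSum I COmega → C := fun x => match x with
    | .unit => 1
    | .el i a _ => c i ^ a.exp
  have below : ∀ i j, i < j → ∀ m n, m ≠ 0 → n ≠ 0 → Below (c i ^ m) (c j ^ n) :=
    fun i j h m n hm hn => (same_pow (c_ne i) m hm).below_left
      ((same_pow (c_ne j) n hn).below_right (c_below i j h))
  have g_lt : StrictMono g := by
    intro x y h
    rcases x with _ | ⟨i, a, ha⟩
    · exact absurd (OrdSum.le_unit _) h.not_ge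
    rcases y with _ | ⟨j, b, hb⟩
    · exact lt_of_le_of_ne (Integral.le_one _) (same_pow (c_ne i) _ (COmega.exp_ne_zero ha)).1
    rcases OrdSum.el_lt_el.1 h with hij | ⟨rfl, hab⟩
    · exact (below i j hij _ _ (COmega.exp_ne_zero ha) (COmega.exp_ne_zero hb)).lt
    · exact pow_lt_pow_of_lt (c_ne i) (by
        by_contra! k
        exact hab.not_ge k)
  refine ⟨g, g_lt.injective, isHom_of_strictMono rfl g_lt fun x y => ?_⟩
  rcases x with _ | ⟨i, a, ha⟩
  · exact (one_mul (g y)).symm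
  rcases y with _ | ⟨j, b, hb⟩
  · exact (mul_one _).symm
  rw [OrdSum.el_mul_el]
  rcases lt_trichotomy i j with hij | rfl | hij
  · rw [if_pos hij]
    exact (below i j hij _ _ (COmega.exp_ne_zero ha) (COmega.exp_ne_zero hb)).2.2.symm
  · rw [if_neg (lt_irrefl _), if_neg (lt_irrefl _)]
    exact pow_add (c i) a.exp b.exp
  · rw [if_neg hij.not_gt, if_pos hij, mul_comm]
    exact (below j i hij _ _ (COmega.exp_ne_zero hb) (COmega.exp_ne_zero ha)).2.2.symm

/-! ### Local embeddings into ordinal sums of copies of `C_ω` -/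

/-- The component of r with the unit is a cancellative ordered monoid, so `exists_exponents` applies
to the part of S inside it. The value 0 elsewhere is a dummy. -/
theorem exists_component_exponents (r : C) (S : Finset C) :
    ∃ φ : C → ℕ,
      (∀ x ∈ S, ∀ y ∈ S, x * y ∈ S → Same x r → Same y r → φ (x * y) = φ x + φ y) ∧
      (∀ x ∈ S, ∀ y ∈ S, Same x r → Same y r → x < y → φ y < φ x) ∧
      ∀ x ∈ S, Same x r → φ x ≠ 0 := by
  classical
  obtain ⟨φ, h_mul, h_lt, h_pos⟩ := exists_exponents (M := component r)
    (fun x => (Integral.le_one (x : C) : (x : C) ≤ 1)) (S.subtype (· ∈ component r))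
  refine ⟨fun x => if h : x ∈ component r then φ ⟨x, h⟩ else 0, ?_, ?_, ?_⟩
  · intro x hx y hy hxy hxr hyr
    have mx : x ∈ component r := Or.inr hxr
    have my : y ∈ component r := Or.inr hyr
    have mxy : x * y ∈ component r := mul_mem mx my
    simp only [dif_pos mx, dif_pos my, dif_pos mxy]
    exact h_mul ⟨x, mx⟩ (by simpa using hx) ⟨y, my⟩ (by simpa using hy) (by simpa using hxy)
  · intro x hx y hy hxr hyr h
    have mx : x ∈ component r := Or.inr hxr
    have my : y ∈ component r := Or.inr hyr
    simp only [dif_pos mx, dif_pos my]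
    exact h_lt ⟨x, mx⟩ (by simpa using hx) ⟨y, my⟩ (by simpa using hy) h
  · intro x hx hxr
    have mx : x ∈ component r := Or.inr hxr
    simp only [dif_pos mx]
    exact (h_pos ⟨x, mx⟩ (by simpa using hx)
      (lt_of_le_of_ne (Integral.le_one x) hxr.1 : x < 1)).ne'

/-- Representatives of the components that meet a finite set. -/
theorem exists_representatives (S : Finset C) :
    ∃ (n : ℕ) (c : Fin n → C), (∀ i, c i ≠ 1) ∧ (∀ i j, i < j → Below (c i) (c j)) ∧
      ∀ x ∈ S, x ≠ 1 → ∃ i, Same x (c i) := by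
  classical
  -- The representative of a component is its least element in S. Ordering the representatives by
  -- size also orders their components.
  let R := S.filter fun r => r ≠ 1 ∧ ∀ s ∈ S, Same s r → r ≤ s
  refine ⟨R.card, R.orderEmbOfFin rfl, fun i => ?_, fun i j h => ?_, fun x hx hx1 => ?_⟩
  · exact (Finset.mem_filter.1 (R.orderEmbOfFin_mem rfl i)).2.1
  · have hi := Finset.mem_filter.1 (R.orderEmbOfFin_mem rfl i)
    have hj := Finset.mem_filter.1 (R.orderEmbOfFin_mem rfl j)
    have hlt := (R.orderEmbOfFin rfl).strictMono h
    rcases same_or_below hi.2.1 hj.2.1 with k | k | k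
    · exact absurd (hj.2.2 _ hi.1 k) hlt.not_ge
    · exact k
    · exact absurd k.lt hlt.not_gt
  · obtain ⟨r, hr, hmin⟩ := (S.filter fun s => Same s x).exists_minimal
      ⟨x, Finset.mem_filter.2 ⟨hx, Same.refl hx1⟩⟩
    rw [Finset.mem_filter] at hr
    have hrR : r ∈ R := Finset.mem_filter.2 ⟨hr.1, hr.2.1, fun s hs hsr =>
      (le_total r s).elim id fun h => hmin (Finset.mem_filter.2 ⟨hs, hsr.trans hr.2⟩) h⟩
    have : r ∈ Set.range (R.orderEmbOfFin rfl) := by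
      rw [Finset.range_orderEmbOfFin]
      exact hrR
    obtain ⟨i, rfl⟩ := this
    exact ⟨i, hr.2.symm⟩

/-- On a finite set, a map into an ordinal sum of copies of `C_ω` that respects order and
product. -/
theorem exists_local_embedding (S : Finset C) :
    ∃ (n : ℕ) (c : Fin n → C) (h : C → OrdSum (Fin n) COmega),
      (∀ i, c i ≠ 1) ∧ (∀ i j, i < j → Below (c i) (c j)) ∧ h 1 = 1 ∧
      (∀ x ∈ S, ∀ y ∈ S, x < y → h x < h y) ∧
      ∀ x ∈ S, ∀ y ∈ S, x * y ∈ S → h (x * y) = h x * h y := by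
  classical
  obtain ⟨n, c, c_ne, c_below, hc⟩ := exists_representatives S
  choose φ φ_mul φ_lt φ_ne using fun i => exists_component_exponents (c i) S
  -- An element of S in the component of `c i` goes to the i-th copy with exponent `φ i x`. The unit
  -- goes to the unit, which is also the default outside S.
  have hex : ∀ x, ∃ z : OrdSum (Fin n) COmega, (x = 1 → z = 1) ∧ (x ∈ S → x ≠ 1 →
      ∃ i h, Same x (c i) ∧ z = .el i ⟨φ i x⟩ h) := by
    intro x
    by_cases h : x ∈ S ∧ x ≠ 1
    · obtain ⟨i, hi⟩ := hc x h.1 h.2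
      exact ⟨.el i ⟨φ i x⟩ (COmega.lt_one (φ_ne i x h.1 hi)), fun e => absurd e h.2,
        fun _ _ => ⟨i, _, hi, rfl⟩⟩
    · exact ⟨1, fun _ => rfl, fun h1 h2 => absurd ⟨h1, h2⟩ h⟩
  choose h h_one h_el using hex
  have index_lt : ∀ x y i j, Same x (c i) → Same y (c j) → (Below x y ↔ i < j) := by
    intro x y i j hx hy
    constructor
    · intro hb
      have hb' := hx.symm.below_left (hy.symm.below_right hb)
      rcases lt_trichotomy i j with hij | rfl | hij
      · exact hij
      · exact absurd hb' (Below.irrefl _)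
      · exact absurd (hb'.trans (c_below j i hij)) (Below.irrefl _)
    · intro hij
      exact hx.below_left (hy.below_right (c_below i j hij))
  refine ⟨n, c, h, c_ne, c_below, h_one 1 rfl, fun x hx y hy hxy => ?_, fun x hx y hy hxy => ?_⟩
  · have hx1 : x ≠ 1 := (hxy.trans_le (Integral.le_one y)).ne
    obtain ⟨i, hi, hxi, ex⟩ := h_el x hx hx1
    rcases eq_or_ne y 1 with rfl | hy1
    · rw [h_one 1 rfl, ex]
      exact lt_of_le_of_ne (Integral.le_one _) (OrdSum.el_ne_one _ _ _)
    obtain ⟨j, hj, hyj, ey⟩ := h_el y hy hy1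
    rw [ex, ey, OrdSum.el_lt_el]
    rcases lt_trichotomy i j with hij | rfl | hij
    · exact Or.inl hij
    · exact Or.inr ⟨rfl, lt_iff_not_ge.2 fun k => (φ_lt i x hx y hy hxi hyj hxy).not_ge k⟩
    · exact absurd ((index_lt y x j i hyj hxi).2 hij).lt hxy.not_gt
  · rcases eq_or_ne x 1 with rfl | hx1
    · rw [h_one 1 rfl, one_mul, one_mul]
    rcases eq_or_ne y 1 with rfl | hy1
    · rw [h_one 1 rfl, mul_one, mul_one]
    obtain ⟨i, hi, hxi, ex⟩ := h_el x hx hx1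
    obtain ⟨j, hj, hyj, ey⟩ := h_el y hy hy1
    rcases lt_trichotomy i j with hij | rfl | hij
    · rw [((index_lt x y i j hxi hyj).2 hij).2.2, ex, ey, OrdSum.el_mul_el, if_pos hij]
    -- The product stays in the common component, so the index chosen for it must again be i, and
    -- additivity of `φ i` applies.
    · obtain ⟨l, hl, hl', e⟩ := h_el (x * y) hxy (mul_ne_one hx1 y)
      have hs := hxi.mul hyj
      have hli : l = i := by
        rcases lt_trichotomy l i with k | k | k
        · exact absurd ((index_lt _ _ _ _ hl' hs).2 k) (Below.irrefl _)
        · exact k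
        · exact absurd ((index_lt _ _ _ _ hs hl').2 k) (Below.irrefl _)
      subst hli
      rw [e, ex, ey, OrdSum.el_mul_el, if_neg (lt_irrefl _), if_neg (lt_irrefl _)]
      congr 1
      exact COmega.ext (φ_mul l x hx y hy hxy hxi hyj)
    · rw [mul_comm x y, ((index_lt y x j i hyj hxi).2 hij).2.2, ex, ey, OrdSum.el_mul_el,
        if_neg hij.not_gt, if_pos hij]

end Hom

/-! ### Refutation of equations -/

/-- The values of the subterms of a term -/
def RLTerm.values {A : Type u} [Lattice A] [CommMonoid A] [Residuated A] (x : ℕ → A) :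
    RLTerm → Set A
  | .var n => {x n}
  | .one => {1}
  | .sup s t => insert (eval x (.sup s t)) (s.values x ∪ t.values x)
  | .inf s t => insert (eval x (.inf s t)) (s.values x ∪ t.values x)
  | .mul s t => insert (eval x (.mul s t)) (s.values x ∪ t.values x)
  | .imp s t => insert (eval x (.imp s t)) (s.values x ∪ t.values x)

theorem RLTerm.finite_values {A : Type u} [Lattice A] [CommMonoid A] [Residuated A] (x : ℕ → A)
    (t : RLTerm) : (t.values x).Finite := by
  induction t with
  | var n => exact Set.finite_singleton _
  | one => exact Set.finite_singleton _
  | sup s t hs ht => exact (hs.union ht).insert _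
  | inf s t hs ht => exact (hs.union ht).insert _
  | mul s t hs ht => exact (hs.union ht).insert _
  | imp s t hs ht => exact (hs.union ht).insert _

theorem RLTerm.eval_mem_values {A : Type u} [Lattice A] [CommMonoid A] [Residuated A] (x : ℕ → A)
    (t : RLTerm) : t.eval x ∈ t.values x := by
  cases t <;> simp [values, eval]

theorem IsHom.map_eval {A : Type u} {B : Type v} [Lattice A] [CommMonoid A] [Residuated A]
    [Lattice B] [CommMonoid B] [Residuated B] {f : A → B} (hf : IsHom f) (x : ℕ → A)
    (t : RLTerm) : f (t.eval x) = t.eval (f ∘ x) := by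
  induction t with
  | var n => rfl
  | one => exact hf.map_one
  | sup s t hs ht => exact (hf.map_sup _ _).trans (congrArg₂ _ hs ht)
  | inf s t hs ht => exact (hf.map_inf _ _).trans (congrArg₂ _ hs ht)
  | mul s t hs ht => exact (hf.map_mul _ _).trans (congrArg₂ _ hs ht)
  | imp s t hs ht => exact (hf.map_himp _ _).trans (congrArg₂ _ hs ht)

section Refute

variable {C : Type u} [LinearOrder C] [CommMonoid C] [Residuated C] [Integral C] [IsOmega C]

/-- A partial homomorphism commutes with a term as soon as its domain S contains the values of all
subterms. Joins and meets are preserved because C is a chain. -/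
theorem map_eval_of_values_subset {D : Type v} [LinearOrder D] [CommMonoid D] [Residuated D]
    [Integral D] [IsOmega D] {h : C → D} {S : Set C} (h_one : h 1 = 1) (one_mem : 1 ∈ S)
    (h_lt : ∀ x ∈ S, ∀ y ∈ S, x < y → h x < h y)
    (h_mul : ∀ x ∈ S, ∀ y ∈ S, x * y ∈ S → h (x * y) = h x * h y) (x : ℕ → C) (t : RLTerm)
    (ht : t.values x ⊆ S) : h (t.eval x) = t.eval (h ∘ x) := by
  have h_le : ∀ a ∈ S, ∀ b ∈ S, a ≤ b → h a ≤ h b := fun a ha b hb hab => by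
    rcases hab.lt_or_eq with hab | rfl
    · exact (h_lt a ha b hb hab).le
    · exact le_rfl
  induction t with
  | var n => rfl
  | one => exact h_one
  | sup s t hs ht' =>
    obtain ⟨_, h1⟩ := Set.insert_subset_iff.1 ht
    obtain ⟨hsS, htS⟩ := Set.union_subset_iff.1 h1
    have ms := hsS (s.eval_mem_values x)
    have mt := htS (t.eval_mem_values x)
    simp only [RLTerm.eval]
    rw [← hs hsS, ← ht' htS]
    rcases le_total (s.eval x) (t.eval x) with k | k
    · rw [sup_eq_right.2 k, sup_eq_right.2 (h_le _ ms _ mt k)]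
    · rw [sup_eq_left.2 k, sup_eq_left.2 (h_le _ mt _ ms k)]
  | inf s t hs ht' =>
    obtain ⟨_, h1⟩ := Set.insert_subset_iff.1 ht
    obtain ⟨hsS, htS⟩ := Set.union_subset_iff.1 h1
    have ms := hsS (s.eval_mem_values x)
    have mt := htS (t.eval_mem_values x)
    simp only [RLTerm.eval]
    rw [← hs hsS, ← ht' htS]
    rcases le_total (s.eval x) (t.eval x) with k | k
    · rw [inf_eq_left.2 k, inf_eq_left.2 (h_le _ ms _ mt k)]
    · rw [inf_eq_right.2 k, inf_eq_right.2 (h_le _ mt _ ms k)]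
  | mul s t hs ht' =>
    obtain ⟨m, h1⟩ := Set.insert_subset_iff.1 ht
    obtain ⟨hsS, htS⟩ := Set.union_subset_iff.1 h1
    exact (h_mul _ (hsS (s.eval_mem_values x)) _ (htS (t.eval_mem_values x)) m).trans
      (congrArg₂ _ (hs hsS) (ht' htS))
  | imp s t hs ht' =>
    obtain ⟨m, h1⟩ := Set.insert_subset_iff.1 ht
    obtain ⟨hsS, htS⟩ := Set.union_subset_iff.1 h1
    exact (map_res_of_map_mul h_one one_mem h_lt h_mul (hsS (s.eval_mem_values x))
      (htS (t.eval_mem_values x)) m).trans (congrArg₂ _ (hs hsS) (ht' htS))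

/-- An equation that fails in a chain of `Ω(C)` fails in a subalgebra of this chain which is a
finite ordinal sum of copies of `C_ω`. -/
theorem exists_ordSum_refutation (x : ℕ → C) (s t : RLTerm) (hst : s.eval x ≠ t.eval x) :
    ∃ k : ℕ, (∃ g : OrdSum (Fin (k + 1)) COmega → C, Function.Injective g ∧ IsHom g) ∧
      ∃ y : ℕ → OrdSum (Fin (k + 1)) COmega, s.eval y ≠ t.eval y := by
  have hfin : (insert 1 (s.values x ∪ t.values x)).Finite :=
    ((s.finite_values x).union (t.finite_values x)).insert 1
  obtain ⟨n, c, h, c_ne, c_below, h_one, h_lt, h_mul⟩ := exists_local_embedding hfin.toFinset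
  simp only [Set.Finite.mem_toFinset] at h_lt h_mul
  have one_mem : (1 : C) ∈ insert 1 (s.values x ∪ t.values x) := Set.mem_insert _ _
  have hs := map_eval_of_values_subset h_one one_mem h_lt h_mul x s
    (Set.subset_union_left.trans (Set.subset_insert _ _))
  have ht := map_eval_of_values_subset h_one one_mem h_lt h_mul x t
    (Set.subset_union_right.trans (Set.subset_insert _ _))
  have ms : s.eval x ∈ insert 1 (s.values x ∪ t.values x) := by simp [RLTerm.eval_mem_values]
  have mt : t.eval x ∈ insert 1 (s.values x ∪ t.values x) := by simp [RLTerm.eval_mem_values]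
  have hne : s.eval (h ∘ x) ≠ t.eval (h ∘ x) := by
    rw [← hs, ← ht]
    rcases hst.lt_or_gt with k | k
    · exact (h_lt _ ms _ mt k).ne
    · exact (h_lt _ mt _ ms k).ne'
  -- The empty ordinal sum has only the unit and refutes nothing, so at least one copy occurs.
  obtain _ | k := n
  · have : ∀ z : OrdSum (Fin 0) COmega, z = 1 := fun z => by
      rcases z with _ | ⟨i, _, _⟩
      · rfl
      · exact i.elim0
    exact absurd ((this _).trans (this _).symm) hne
  · exact ⟨k, exists_embedding c c_ne c_below, h ∘ x, hne⟩

end Refute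

/-! ### Prime filters -/

/-- Filters of an integral residuated lattice -/
structure IsImplicativeFilter {L : Type u} [Lattice L] [CommMonoid L] (F : Set L) : Prop where
  one_mem : 1 ∈ F
  mem_of_le : ∀ x ∈ F, ∀ y, x ≤ y → y ∈ F
  mul_mem : ∀ x ∈ F, ∀ y ∈ F, x * y ∈ F

/-- Filters with a totally ordered quotient -/
structure PrimeFilter (L : Type u) [Lattice L] [CommMonoid L] [Residuated L] where
  carrier : Set L
  isFilter : IsImplicativeFilter carrier
  total : ∀ x y : L, x ⇨ y ∈ carrier ∨ y ⇨ x ∈ carrier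

section Existence

variable {L : Type u} [Lattice L] [CommMonoid L] [Residuated L] [Integral L]

/-- By induction, 1 = (p ∨ q)(p ∨ qⁿ) ≤ p ∨ qⁿ⁺¹. -/
theorem sup_pow_eq_one {p q : L} (h : p ⊔ q = 1) : ∀ n : ℕ, p ⊔ q ^ n = 1
  | 0 => by rw [pow_zero, ← Residuated.one_le]; exact le_sup_right
  | n + 1 => by
    rw [← Residuated.one_le]
    calc (1 : L) = (p ⊔ q) * (p ⊔ q ^ n) := by rw [h, sup_pow_eq_one h n, one_mul]
      _ ≤ p ⊔ q ^ (n + 1) := by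
        rw [mul_sup_eq]
        refine sup_le ((mul_le_right _ _).trans le_sup_left) ?_
        rw [mul_comm, mul_sup_eq]
        exact sup_le ((mul_le_right _ _).trans le_sup_left) (pow_succ q n ▸ le_sup_right)

theorem pow_sup_pow_eq_one {p q : L} (h : p ⊔ q = 1) (m n : ℕ) : p ^ m ⊔ q ^ n = 1 := by
  rw [sup_comm]
  exact sup_pow_eq_one (by rw [sup_comm]; exact sup_pow_eq_one h n) m

/-- The filter generated by a filter and an element -/
theorem IsImplicativeFilter.adjoin {F : Set L} (hF : IsImplicativeFilter F) (p : L) :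
    IsImplicativeFilter {z | ∃ f ∈ F, ∃ n : ℕ, f * p ^ n ≤ z} where
  one_mem := ⟨1, hF.one_mem, 0, Residuated.le_one _⟩
  mem_of_le := by
    rintro x ⟨f, hf, n, h⟩ y hxy
    exact ⟨f, hf, n, h.trans hxy⟩
  mul_mem := by
    rintro x ⟨f, hf, n, h⟩ y ⟨g, hg, m, k⟩
    refine ⟨f * g, hF.mul_mem f hf g hg, n + m, ?_⟩
    rw [pow_add, mul_mul_mul_comm]
    exact mul_mono h k

/-- Take a filter maximal among those omitting a. If it contained neither p = x → y nor q = y → x,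
adjoining either would yield fpⁿ ≤ a and gqᵐ ≤ a with f, g in the filter. As pⁿ ∨ qᵐ = 1, this gives
fg ≤ a, a contradiction. -/
theorem exists_primeFilter (hL : ∀ x y : L, (x ⇨ y) ⊔ (y ⇨ x) = 1) {a : L} (ha : a ≠ 1) :
    ∃ F : PrimeFilter L, a ∉ F.carrier := by
  obtain ⟨M, -, ⟨hM, haM⟩, hmax⟩ := zorn_subset_nonempty
    {F : Set L | IsImplicativeFilter F ∧ a ∉ F} (by
      intro c hc hchain ⟨F₀, hF₀⟩
      refine ⟨⋃₀ c, ⟨⟨⟨F₀, hF₀, (hc hF₀).1.one_mem⟩, ?_, ?_⟩, ?_⟩, fun s => Set.subset_sUnion_of_mem⟩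
      · rintro x ⟨F, hF, hx⟩ y hxy
        exact ⟨F, hF, (hc hF).1.mem_of_le x hx y hxy⟩
      · rintro x ⟨F, hF, hx⟩ y ⟨G, hG, hy⟩
        rcases hchain.total hF hG with h | h
        · exact ⟨G, hG, (hc hG).1.mul_mem x (h hx) y hy⟩
        · exact ⟨F, hF, (hc hF).1.mul_mem x hx y (h hy)⟩
      · rintro ⟨F, hF, h⟩
        exact (hc hF).2 h) {1}
    ⟨⟨rfl, fun x hx y h => Residuated.one_le.1 (by rwa [Set.mem_singleton_iff.1 hx] at h),
      fun x hx y hy => by simp_all⟩, ha⟩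
  have key : ∀ p, p ∉ M → ∃ f ∈ M, ∃ n : ℕ, f * p ^ n ≤ a := by
    intro p hp
    by_contra hcon
    have hsub : M ⊆ {z | ∃ f ∈ M, ∃ n : ℕ, f * p ^ n ≤ z} :=
      fun x hx => ⟨x, hx, 0, by rw [pow_zero, mul_one]⟩
    exact hp (hmax ⟨hM.adjoin p, hcon⟩ hsub ⟨1, hM.one_mem, 1, by rw [pow_one, one_mul]⟩)
  refine ⟨⟨M, hM, fun x y => ?_⟩, haM⟩
  by_contra! hcon
  obtain ⟨f, hf, n, h⟩ := key _ hcon.1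
  obtain ⟨g, hg, m, k⟩ := key _ hcon.2
  refine haM (hM.mem_of_le _ (hM.mul_mem f hf g hg) a ?_)
  calc f * g = f * g * ((x ⇨ y) ^ n ⊔ (y ⇨ x) ^ m) := by
        rw [pow_sup_pow_eq_one (hL x y), mul_one]
    _ ≤ a := by
      rw [mul_sup_eq]
      refine sup_le ?_ ?_
      · rw [mul_right_comm]
        exact (mul_le_left _ _).trans h
      · rw [mul_assoc]
        exact (mul_le_right _ _).trans k

end Existence

/-! ### The chain of a prime filter -/

namespace PrimeFilter

variable {L : Type u} [Lattice L] [CommMonoid L] [Residuated L] [Integral L]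
variable (F : PrimeFilter L)

/-- The preorder of a filter -/
def Le (x y : L) : Prop := x ⇨ y ∈ F.carrier

variable {F}

theorem Le.of_le {x y : L} (h : x ≤ y) : F.Le x y := by
  rw [Le, res_eq_one.2 h]
  exact F.isFilter.one_mem

theorem le_of_mul_le {p q x y : L} (hp : p ∈ F.carrier) (hq : q ∈ F.carrier) (h : p * q * x ≤ y) :
    F.Le x y :=
  F.isFilter.mem_of_le _ (F.isFilter.mul_mem p hp q hq) _ (le_res_iff.2 h)

theorem Le.trans {x y z : L} (h : F.Le x y) (k : F.Le y z) : F.Le x z :=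
  le_of_mul_le k h (by
    rw [mul_assoc]
    exact (mul_mono_right (res_mul_le x y) _).trans (res_mul_le y z))

theorem Le.mul {x x' y y' : L} (h : F.Le x x') (k : F.Le y y') : F.Le (x * y) (x' * y') :=
  le_of_mul_le h k (by
    rw [mul_mul_mul_comm]
    exact mul_mono (res_mul_le _ _) (res_mul_le _ _))

theorem Le.res {x x' y y' : L} (h : F.Le x' x) (k : F.Le y y') : F.Le (x ⇨ y) (x' ⇨ y') :=
  le_of_mul_le k h (by
    rw [le_res_iff]
    calc (y ⇨ y') * (x' ⇨ x) * (x ⇨ y) * x'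
        = (y ⇨ y') * ((x ⇨ y) * ((x' ⇨ x) * x')) := by ac_rfl
      _ ≤ (y ⇨ y') * ((x ⇨ y) * x) := mul_mono_right (mul_mono_right (res_mul_le _ _) _) _
      _ ≤ (y ⇨ y') * y := mul_mono_right (res_mul_le _ _) _
      _ ≤ y' := res_mul_le _ _)

variable (F)

/-- The congruence of a filter -/
def setoid : Setoid L where
  r x y := F.Le x y ∧ F.Le y x
  iseqv := ⟨fun _ => ⟨.of_le le_rfl, .of_le le_rfl⟩, fun h => ⟨h.2, h.1⟩,
    fun h k => ⟨h.1.trans k.1, k.2.trans h.2⟩⟩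

/-- The quotient of a residuated lattice by a prime filter -/
def Chain : Type u := Quotient F.setoid

/-- The quotient map -/
def proj (x : L) : F.Chain := Quotient.mk F.setoid x

variable {F}

theorem proj_surjective : Function.Surjective F.proj := Quotient.exists_rep

theorem proj_eq_proj {x y : L} : F.proj x = F.proj y ↔ F.Le x y ∧ F.Le y x := Quotient.eq

noncomputable instance : LinearOrder F.Chain where
  le := Quotient.lift₂ F.Le fun _ _ _ _ h k =>
    propext ⟨fun l => (h.2.trans l).trans k.1, fun l => (h.1.trans l).trans k.2⟩
  le_refl x := by
    obtain ⟨x, rfl⟩ := proj_surjective x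
    exact Le.of_le le_rfl
  le_trans x y z := by
    obtain ⟨x, rfl⟩ := proj_surjective x
    obtain ⟨y, rfl⟩ := proj_surjective y
    obtain ⟨z, rfl⟩ := proj_surjective z
    exact Le.trans
  le_antisymm x y := by
    obtain ⟨x, rfl⟩ := proj_surjective x
    obtain ⟨y, rfl⟩ := proj_surjective y
    exact fun h k => proj_eq_proj.2 ⟨h, k⟩
  le_total x y := by
    obtain ⟨x, rfl⟩ := proj_surjective x
    obtain ⟨y, rfl⟩ := proj_surjective y
    exact F.total x y
  toDecidableLE := Classical.decRel _

instance : CommMonoid F.Chain where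
  one := F.proj 1
  mul := Quotient.map₂ (· * ·) fun _ _ h _ _ k => ⟨h.1.mul k.1, h.2.mul k.2⟩
  mul_assoc x y z := by
    obtain ⟨x, rfl⟩ := proj_surjective x
    obtain ⟨y, rfl⟩ := proj_surjective y
    obtain ⟨z, rfl⟩ := proj_surjective z
    exact congrArg F.proj (mul_assoc x y z)
  one_mul x := by
    obtain ⟨x, rfl⟩ := proj_surjective x
    exact congrArg F.proj (one_mul x)
  mul_one x := by
    obtain ⟨x, rfl⟩ := proj_surjective x
    exact congrArg F.proj (mul_one x)
  mul_comm x y := by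
    obtain ⟨x, rfl⟩ := proj_surjective x
    obtain ⟨y, rfl⟩ := proj_surjective y
    exact congrArg F.proj (mul_comm x y)

instance : Residuated F.Chain where
  himp := Quotient.map₂ (· ⇨ ·) fun _ _ h _ _ k => ⟨h.2.res k.1, h.1.res k.2⟩
  mul_le_iff_le_himp x y z := by
    obtain ⟨x, rfl⟩ := proj_surjective x
    obtain ⟨y, rfl⟩ := proj_surjective y
    obtain ⟨z, rfl⟩ := proj_surjective z
    change (x * y) ⇨ z ∈ F.carrier ↔ x ⇨ (y ⇨ z) ∈ F.carrier
    rw [res_res]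

instance : Integral F.Chain where
  le_one x := by
    obtain ⟨x, rfl⟩ := proj_surjective x
    exact Le.of_le (Residuated.le_one x)

instance [IsOmega L] : IsOmega F.Chain where
  divisible x y := by
    obtain ⟨x, rfl⟩ := proj_surjective x
    obtain ⟨y, rfl⟩ := proj_surjective y
    exact congrArg F.proj (divisible x y)
  himp_sq x := by
    obtain ⟨x, rfl⟩ := proj_surjective x
    rw [sq]
    exact congrArg F.proj (res_mul_self x)

theorem isHom_proj : IsHom F.proj where
  map_mul _ _ := rfl
  map_himp _ _ := rfl
  map_one := rfl
  map_sup x y := by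
    rcases le_total (F.proj x) (F.proj y) with h | h
    · rw [sup_eq_right.2 h, proj_eq_proj]
      refine ⟨?_, .of_le le_sup_right⟩
      rw [Le, sup_res, res_self, inf_eq_left.2 (Residuated.le_one _)]
      exact h
    · rw [sup_eq_left.2 h, proj_eq_proj]
      refine ⟨?_, .of_le le_sup_left⟩
      rw [Le, sup_res, res_self, inf_eq_right.2 (Residuated.le_one _)]
      exact h
  map_inf x y := by
    rcases le_total (F.proj x) (F.proj y) with h | h
    · rw [inf_eq_left.2 h, proj_eq_proj]
      refine ⟨.of_le inf_le_left, ?_⟩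
      rw [Le, res_inf, res_self, inf_eq_right.2 (Residuated.le_one _)]
      exact h
    · rw [inf_eq_right.2 h, proj_eq_proj]
      refine ⟨.of_le inf_le_right, ?_⟩
      rw [Le, res_inf, res_self, inf_eq_left.2 (Residuated.le_one _)]
      exact h

end PrimeFilter

/-- Distinct elements are separated by some chain. -/
theorem exists_primeFilter_separating {L : Type u} [Lattice L] [CommMonoid L] [Residuated L]
    [Integral L] (hL : ∀ x y : L, (x ⇨ y) ⊔ (y ⇨ x) = 1) {x y : L} (h : x ≠ y) :
    ∃ F : PrimeFilter L, F.proj x ≠ F.proj y := by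
  by_cases hxy : x ⇨ y = 1
  · have hyx : y ⇨ x ≠ 1 := fun k => h (le_antisymm (res_eq_one.1 hxy) (res_eq_one.1 k))
    obtain ⟨F, hF⟩ := exists_primeFilter hL hyx
    exact ⟨F, fun e => hF (PrimeFilter.proj_eq_proj.1 e).2⟩
  · obtain ⟨F, hF⟩ := exists_primeFilter hL hxy
    exact ⟨F, fun e => hF (PrimeFilter.proj_eq_proj.1 e).1⟩

/-! ### Preservation of equations -/

/-- Unbundled form of `Satisfies` -/
def Sat (A : Type u) [Lattice A] [CommMonoid A] [Residuated A] (e : RLTerm × RLTerm) : Prop :=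
  ∀ x : ℕ → A, e.1.eval x = e.2.eval x

section Sat

variable {A : Type u} {B : Type v} [Lattice A] [CommMonoid A] [Residuated A] [Lattice B]
  [CommMonoid B] [Residuated B] {f : A → B} {e : RLTerm × RLTerm}

theorem Sat.of_injective (hf : IsHom f) (hinj : Function.Injective f) (h : Sat B e) : Sat A e :=
  fun x => hinj (by rw [hf.map_eval, hf.map_eval, h])

theorem Sat.of_surjective (hf : IsHom f) (hsurj : Function.Surjective f) (h : Sat A e) :
    Sat B e := by
  intro y
  obtain ⟨x, rfl⟩ := hsurj.comp_left y
  rw [← hf.map_eval, ← hf.map_eval, h]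

end Sat

theorem IsHom.comp {A B C : Type*} [Lattice A] [CommMonoid A] [Residuated A] [Lattice B]
    [CommMonoid B] [Residuated B] [Lattice C] [CommMonoid C] [Residuated C] {g : B → C}
    {f : A → B} (hg : IsHom g) (hf : IsHom f) : IsHom (g ∘ f) where
  map_sup x y := by simp only [Function.comp, hf.map_sup, hg.map_sup]
  map_inf x y := by simp only [Function.comp, hf.map_inf, hg.map_inf]
  map_mul x y := by simp only [Function.comp, hf.map_mul, hg.map_mul]
  map_himp x y := by simp only [Function.comp, hf.map_himp, hg.map_himp]
  map_one := by simp only [Function.comp, hf.map_one, hg.map_one]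

/-! ### The K-expansion -/

namespace KExp

section Ops

variable {L : Type u} [Lattice L]

@[simp] theorem fst_sup (x y : KExp L) : (x ⊔ y).fst = x.fst ⊔ y.fst := rfl
@[simp] theorem snd_sup (x y : KExp L) : (x ⊔ y).snd = x.snd ⊓ y.snd := rfl
@[simp] theorem fst_inf (x y : KExp L) : (x ⊓ y).fst = x.fst ⊓ y.fst := rfl
@[simp] theorem snd_inf (x y : KExp L) : (x ⊓ y).snd = x.snd ⊔ y.snd := rfl

variable [CommMonoid L] [Residuated L] [Integral L]

@[simp] theorem fst_one : (1 : KExp L).fst = 1 := rfl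
@[simp] theorem snd_one : (1 : KExp L).snd = 1 := rfl
@[simp] theorem fst_mul (x y : KExp L) : (x * y).fst = x.fst * y.fst := rfl
@[simp] theorem snd_mul (x y : KExp L) :
    (x * y).snd = (x.fst ⇨ y.snd) ⊓ (y.fst ⇨ x.snd) := rfl
@[simp] theorem fst_himp (x y : KExp L) :
    (x ⇨ y).fst = (x.fst ⇨ y.fst) ⊓ (y.snd ⇨ x.snd) := rfl
@[simp] theorem snd_himp (x y : KExp L) : (x ⇨ y).snd = x.fst * y.snd := rfl

end Ops

section Map

variable {L : Type u} {M : Type v} [Lattice L] [CommMonoid L] [Residuated L] [Integral L]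
  [Lattice M] [CommMonoid M] [Residuated M] [Integral M] {f : L → M}

/-- The K-expansion of a map -/
def map (f : L → M) (x : KExp L) : KExp M := ⟨f x.fst, f x.snd⟩

theorem isHom_map (hf : IsHom f) : IsHom (map f) where
  map_sup _ _ := KExp.ext (hf.map_sup _ _) (hf.map_inf _ _)
  map_inf _ _ := KExp.ext (hf.map_inf _ _) (hf.map_sup _ _)
  map_mul _ _ := KExp.ext (hf.map_mul _ _)
    ((hf.map_inf _ _).trans (congrArg₂ _ (hf.map_himp _ _) (hf.map_himp _ _)))
  map_himp _ _ := KExp.ext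
    ((hf.map_inf _ _).trans (congrArg₂ _ (hf.map_himp _ _) (hf.map_himp _ _))) (hf.map_mul _ _)
  map_one := KExp.ext hf.map_one hf.map_one

theorem map_injective (hf : Function.Injective f) : Function.Injective (map f) := fun _ _ h =>
  KExp.ext (hf (congrArg KExp.fst h)) (hf (congrArg KExp.snd h))

end Map

section Eval

variable {L : Type u} [Lattice L] [CommMonoid L] [Residuated L] [Integral L]

/-- The coordinates of a term evaluated in a K-expansion, as terms in the coordinates of the
variables -/
def coordTerms : RLTerm → RLTerm × RLTerm
  | .var n => (.var (2 * n), .var (2 * n + 1))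
  | .one => (.one, .one)
  | .sup s t => (.sup (coordTerms s).1 (coordTerms t).1, .inf (coordTerms s).2 (coordTerms t).2)
  | .inf s t => (.inf (coordTerms s).1 (coordTerms t).1, .sup (coordTerms s).2 (coordTerms t).2)
  | .mul s t => (.mul (coordTerms s).1 (coordTerms t).1,
      .inf (.imp (coordTerms s).1 (coordTerms t).2) (.imp (coordTerms t).1 (coordTerms s).2))
  | .imp s t => (.inf (.imp (coordTerms s).1 (coordTerms t).1)
      (.imp (coordTerms t).2 (coordTerms s).2), .mul (coordTerms s).1 (coordTerms t).2)

theorem eval_eq {x : ℕ → KExp L} {y : ℕ → L} (h₁ : ∀ n, y (2 * n) = (x n).fst)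
    (h₂ : ∀ n, y (2 * n + 1) = (x n).snd) (t : RLTerm) :
    t.eval x = ⟨(coordTerms t).1.eval y, (coordTerms t).2.eval y⟩ := by
  induction t with
  | var n => exact KExp.ext (h₁ n).symm (h₂ n).symm
  | one => rfl
  | sup s t hs ht => simp only [RLTerm.eval, coordTerms, hs, ht]; rfl
  | inf s t hs ht => simp only [RLTerm.eval, coordTerms, hs, ht]; rfl
  | mul s t hs ht => simp only [RLTerm.eval, coordTerms, hs, ht]; rfl
  | imp s t hs ht => simp only [RLTerm.eval, coordTerms, hs, ht]; rfl

/-- An equation holds in the K-expansion of `L` if and only if both of its coordinates hold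
in `L`. -/
theorem sat_iff (e : RLTerm × RLTerm) :
    Sat (KExp L) e ↔ Sat L ((coordTerms e.1).1, (coordTerms e.2).1) ∧
      Sat L ((coordTerms e.1).2, (coordTerms e.2).2) := by
  constructor
  · intro h
    have key : ∀ y : ℕ → L, (⟨(coordTerms e.1).1.eval y, (coordTerms e.1).2.eval y⟩ : KExp L) =
        ⟨(coordTerms e.2).1.eval y, (coordTerms e.2).2.eval y⟩ := fun y => by
      rw [← eval_eq (x := fun n => ⟨y (2 * n), y (2 * n + 1)⟩) (fun _ => rfl) (fun _ => rfl),
        ← eval_eq (x := fun n => ⟨y (2 * n), y (2 * n + 1)⟩) (fun _ => rfl) (fun _ => rfl), h]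
    exact ⟨fun y => congrArg KExp.fst (key y), fun y => congrArg KExp.snd (key y)⟩
  · rintro ⟨h₁, h₂⟩ x
    -- Even variables carry the first coordinates and odd variables the second ones.
    let y : ℕ → L := fun n => if n % 2 = 0 then (x (n / 2)).fst else (x (n / 2)).snd
    have y₁ : ∀ n, y (2 * n) = (x n).fst := fun n => by simp [y]
    have y₂ : ∀ n, y (2 * n + 1) = (x n).snd := fun n => by
      simp only [y]
      rw [if_neg (by omega), show (2 * n + 1) / 2 = n by omega]
    rw [eval_eq y₁ y₂, eval_eq y₁ y₂]
    exact KExp.ext (h₁ y) (h₂ y)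

/-- K-expansions are K-lattices. -/
theorem mem_KL : CRLAlg.mk (KExp L) ∈ KL := by
  have le := Integral.le_one (A := L)
  refine ⟨fun x => ?_, ?_, fun x y => ?_, fun x y => ?_⟩
  · apply KExp.ext <;> simp [res_one, one_res, le]
  · intro x y z h
    rcases h with rfl | rfl | rfl <;> constructor <;> apply KExp.ext <;> simp [le]
  · apply KExp.ext <;> simp [le, res_one]
  · apply KExp.ext <;> simp [le, res_one, one_res, mul_comm]
end Eval

end KExp

/-! ### The negative cone -/

section Cone

/-- The negative cone of a commutative residuated lattice -/
def Cone (A : Type u) [Lattice A] [CommMonoid A] : Type u := {x : A // x ≤ 1}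

variable {A : Type u} [Lattice A] [CommMonoid A] [Residuated A]

namespace Cone

instance : Lattice (Cone A) := Subtype.lattice (P := fun x : A => x ≤ 1) (fun _ _ => sup_le)
  (fun _ _ h _ => inf_le_left.trans h)

@[ext] theorem ext {x y : Cone A} (h : x.1 = y.1) : x = y := Subtype.ext h

instance : CommMonoid (Cone A) where
  one := ⟨1, le_rfl⟩
  mul x y := ⟨x.1 * y.1, (mul_mono x.2 y.2).trans (one_mul 1).le⟩
  mul_assoc x y z := Cone.ext (mul_assoc _ _ _)
  one_mul x := Cone.ext (one_mul _)
  mul_one x := Cone.ext (mul_one _)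
  mul_comm x y := Cone.ext (mul_comm _ _)

instance : Residuated (Cone A) where
  himp x y := ⟨(x.1 ⇨ y.1) ⊓ 1, inf_le_right⟩
  mul_le_iff_le_himp x y z := by
    change x.1 * y.1 ≤ z.1 ↔ x.1 ≤ (y.1 ⇨ z.1) ⊓ 1
    rw [le_inf_iff, le_res_iff, and_iff_left x.2]

instance : Integral (Cone A) where
  le_one x := x.2

/-- The projection of `A` to its negative cone -/
def neg (x : A) : Cone A := ⟨x ⊓ 1, inf_le_right⟩

end Cone

/-- The relativization of a term to the negative cone -/
def coneTerm : RLTerm → RLTerm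
  | .var n => .inf (.var n) .one
  | .one => .one
  | .sup s t => .sup (coneTerm s) (coneTerm t)
  | .inf s t => .inf (coneTerm s) (coneTerm t)
  | .mul s t => .mul (coneTerm s) (coneTerm t)
  | .imp s t => .inf (.imp (coneTerm s) (coneTerm t)) .one

theorem eval_coneTerm (x : ℕ → A) (t : RLTerm) :
    (coneTerm t).eval x = (t.eval fun n => Cone.neg (x n)).1 := by
  induction t with
  | var n => rfl
  | one => rfl
  | sup s t hs ht => simp only [coneTerm, RLTerm.eval, hs, ht]; rfl
  | inf s t hs ht => simp only [coneTerm, RLTerm.eval, hs, ht]; rfl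
  | mul s t hs ht => simp only [coneTerm, RLTerm.eval, hs, ht]; rfl
  | imp s t hs ht => simp only [coneTerm, RLTerm.eval, hs, ht]; rfl

/-- The relativization of an equation to the negative cone -/
def coneEq (e : RLTerm × RLTerm) : RLTerm × RLTerm := (coneTerm e.1, coneTerm e.2)

theorem sat_coneEq (e : RLTerm × RLTerm) : Sat A (coneEq e) ↔ Sat (Cone A) e := by
  constructor
  · intro h x
    have hx : (fun n => Cone.neg (x n).1) = x := funext fun n => Cone.ext (inf_eq_left.2 (x n).2)
    have := h fun n => (x n).1
    simp only [coneEq, eval_coneTerm, hx] at this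
    exact Cone.ext this
  · intro h x
    simp only [coneEq, eval_coneTerm, h fun n => Cone.neg (x n)]

/-- The negative cone of the K-expansion of `L` is `L`. -/
theorem sat_cone_KExp {L : Type u} [Lattice L] [CommMonoid L] [Residuated L] [Integral L]
    (e : RLTerm × RLTerm) : Sat (KExp L) (coneEq e) ↔ Sat L e := by
  rw [sat_coneEq]
  let f : L → Cone (KExp L) := fun a => ⟨⟨a, 1⟩, Integral.le_one a, le_rfl⟩
  have hf : IsHom f :=
    { map_sup := fun _ _ => Cone.ext (KExp.ext rfl (inf_idem (1 : L)).symm)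
      map_inf := fun _ _ => Cone.ext (KExp.ext rfl (sup_idem (1 : L)).symm)
      map_mul := fun x y => Cone.ext (KExp.ext rfl (by
        change 1 = (x ⇨ 1) ⊓ (y ⇨ 1)
        rw [res_one, res_one, inf_idem]))
      map_himp := fun x y => Cone.ext (KExp.ext
        (by
          change x ⇨ y = ((x ⇨ y) ⊓ (1 ⇨ 1)) ⊓ 1
          rw [res_one, inf_eq_left.2 (Integral.le_one _), inf_eq_left.2 (Integral.le_one _)])
        (sup_eq_right.2 (Integral.le_one _)).symm)
      map_one := rfl }
  have hinj : Function.Injective f := fun a b h => congrArg (fun z => z.1.fst) h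
  have hsurj : Function.Surjective f := fun z => ⟨z.1.fst, Cone.ext (KExp.ext rfl
    (Residuated.one_le.1 z.2.2).symm)⟩
  exact ⟨.of_injective hf hinj, .of_surjective hf hsurj⟩

end Cone

/-! ### The representation of K-lattices -/

section Representation

/-- The map of a K-lattice to the K-expansion of its negative cone -/
def toKExp {A : Type u} [Lattice A] [CommMonoid A] [Residuated A] (x : A) : KExp (Cone A) :=
  ⟨Cone.neg x, Cone.neg (x ⇨ 1)⟩

variable {A : CRLAlg.{u}}

theorem sup_inf_one (hA : A ∈ KL) (x y : A) : (x ⊔ y) ⊓ 1 = (x ⊓ 1) ⊔ (y ⊓ 1) := by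
  have := (hA.2.1 1 x y (Or.inl rfl)).1
  rwa [inf_comm, inf_comm 1 x, inf_comm 1 y] at this

theorem inf_res_one (hA : A ∈ KL) (x y : A) : (x ⊓ y) ⇨ 1 = (x ⇨ 1) ⊔ (y ⇨ 1) := by
  rw [← hA.1 ((x ⇨ 1) ⊔ (y ⇨ 1)), sup_res, hA.1, hA.1]

theorem res_inf_one {x y : A} (hx : x ≤ 1) : (x ⇨ y ⊓ 1) ⊓ 1 = (x ⇨ y) ⊓ 1 := by
  rw [res_inf, inf_assoc, inf_eq_right.2 (one_le_res.2 hx)]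

theorem res_eq_mul_res (hA : A ∈ KL) (x y : A) : x ⇨ y = (x * (y ⇨ 1)) ⇨ 1 := by
  rw [← res_res, hA.1]

/-- Each axiom has its place: distributivity at 1 and involution handle the lattice operations, xy ∧
1 = (x ∧ 1)(y ∧ 1) the first coordinate of products, and the last axiom the first coordinate of
residuals. The second coordinates of products and residuals reduce to these, as ∼(xy) = x → ∼y and
∼(x → y) = x · ∼y. -/
theorem isHom_toKExp (hA : A ∈ KL) : IsHom (toKExp : A → KExp (Cone A)) where
  map_one := KExp.ext (Cone.ext (inf_idem _)) (Cone.ext (inf_eq_right.2 (one_le_res.2 le_rfl)))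
  map_sup x y := by
    refine KExp.ext (Cone.ext (sup_inf_one hA x y)) (Cone.ext ?_)
    change ((x ⊔ y) ⇨ 1) ⊓ 1 = ((x ⇨ 1) ⊓ 1) ⊓ ((y ⇨ 1) ⊓ 1)
    rw [sup_res, inf_inf_distrib_right]
  map_inf x y := by
    refine KExp.ext (Cone.ext (inf_inf_distrib_right x y 1)) (Cone.ext ?_)
    change ((x ⊓ y) ⇨ 1) ⊓ 1 = ((x ⇨ 1) ⊓ 1) ⊔ ((y ⇨ 1) ⊓ 1)
    rw [inf_res_one hA, sup_inf_one hA]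
  map_mul x y := by
    refine KExp.ext (Cone.ext (hA.2.2.1 x y)) (Cone.ext ?_)
    change ((x * y) ⇨ 1) ⊓ 1 = ((x ⊓ 1 ⇨ (y ⇨ 1) ⊓ 1) ⊓ 1) ⊓ ((y ⊓ 1 ⇨ (x ⇨ 1) ⊓ 1) ⊓ 1)
    rw [res_inf_one inf_le_right, res_inf_one inf_le_right, ← inf_inf_distrib_right, ← res_res,
      ← hA.2.2.2 x (y ⇨ 1), hA.1]
  map_himp x y := by
    refine KExp.ext (Cone.ext ?_) (Cone.ext ?_)
    · change (x ⇨ y) ⊓ 1 = ((x ⊓ 1 ⇨ y ⊓ 1) ⊓ 1) ⊓ (((y ⇨ 1) ⊓ 1 ⇨ (x ⇨ 1) ⊓ 1) ⊓ 1)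
      rw [res_inf_one inf_le_right, res_inf_one inf_le_right, ← inf_inf_distrib_right,
        hA.2.2.2 x y]
    · change ((x ⇨ y) ⇨ 1) ⊓ 1 = (x ⊓ 1) * ((y ⇨ 1) ⊓ 1)
      rw [res_eq_mul_res hA x y, hA.1, hA.2.2.1]

/-- The second coordinate determines x ∨ 1 = (∼x ∧ 1) → 1, and distributivity at 1 recovers x from x
∧ 1 and x ∨ 1. -/
theorem toKExp_injective (hA : A ∈ KL) : Function.Injective (toKExp : A → KExp (Cone A)) := by
  have key : ∀ x y : A, x ⊓ 1 = y ⊓ 1 → (x ⇨ 1) ⊓ 1 = (y ⇨ 1) ⊓ 1 → x ≤ y := by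
    intro x y h k
    have h' : x ⊔ 1 = y ⊔ 1 := by
      have : ∀ z : A, z ⊔ 1 = ((z ⇨ 1) ⊓ 1) ⇨ 1 := fun z => by
        rw [← hA.1 (z ⊔ 1), sup_res, one_res]
      rw [this, this, k]
    calc x = x ⊓ (y ⊔ 1) := by rw [← h', inf_eq_left.2 le_sup_left]
      _ = (x ⊓ y) ⊔ (x ⊓ 1) := (hA.2.1 x y 1 (Or.inr (Or.inr rfl))).1
      _ ≤ y := sup_le inf_le_right (h ▸ inf_le_left)
  intro x y h
  have h₁ : x ⊓ 1 = y ⊓ 1 := congrArg (fun z => z.fst.1) h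
  have h₂ : (x ⇨ 1) ⊓ 1 = (y ⇨ 1) ⊓ 1 := congrArg (fun z => z.snd.1) h
  exact le_antisymm (key x y h₁ h₂) (key y x h₁.symm h₂.symm)

theorem toKExp_cone (a : Cone A) : toKExp (a.1 : A) = ⟨a, 1⟩ :=
  KExp.ext (Cone.ext (inf_eq_left.2 a.2)) (Cone.ext (inf_eq_right.2 (one_le_res.2 a.2)))

/-- For a chain `C` of `Ω(C)`, every homomorphism from the negative cone of a K-lattice onto `C`
yields a homomorphism onto `K(C)`. -/
theorem map_toKExp_surjective (hA : A ∈ KL) {C : Type v} [LinearOrder C] [CommMonoid C]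
    [Residuated C] [Integral C] [IsOmega C] {f : Cone A → C} (hf : IsHom f)
    (hsurj : Function.Surjective f) :
    Function.Surjective (KExp.map f ∘ (toKExp : A → KExp (Cone A))) := by
  have hom := (KExp.isHom_map hf).comp (isHom_toKExp hA)
  have hcone : ∀ a : C, ∃ x : A, (KExp.map f ∘ toKExp) x = ⟨a, 1⟩ := by
    intro a
    obtain ⟨α, rfl⟩ := hsurj a
    exact ⟨α.1, KExp.ext (congrArg (f ∘ KExp.fst) (toKExp_cone α))
      ((congrArg (f ∘ KExp.snd) (toKExp_cone α)).trans hf.map_one)⟩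
  have hswap : ∀ a b : C, (∃ x : A, (KExp.map f ∘ toKExp) x = ⟨a, b⟩) →
      ∃ x : A, (KExp.map f ∘ toKExp) x = ⟨b, a⟩ := by
    rintro a b ⟨x, hx⟩
    refine ⟨x ⇨ 1, ?_⟩
    rw [hom.map_himp, hom.map_one, hx]
    apply KExp.ext <;> simp [res_one, one_res, Integral.le_one]
  have hres : ∀ a b : C, ∃ x : A, (KExp.map f ∘ toKExp) x = ⟨a, a ⇨ b⟩ := by
    intro a b
    obtain ⟨x, hx⟩ := hcone a
    obtain ⟨y, hy⟩ := hswap b 1 (hcone b)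
    refine ⟨x * y, ?_⟩
    rw [hom.map_mul, hx, hy]
    apply KExp.ext <;> simp [res_one, Integral.le_one]
  -- By `res_mul_eq_or`, either b = a → ab or a = b → ab, so ⟨a, b⟩ or its swap has the form just
  -- reached.
  rintro ⟨a, b⟩
  rcases res_mul_eq_or a b with h | h
  · rw [← h]
    exact h.symm ▸ hres a (a * b)
  · exact hswap b a (by
      have := hres b (a * b)
      rwa [h] at this)

end Representation

/-! ### `K(Ω(C))` is a variety -/

/-- Equations that define K-lattices -/
def eqKL : Set (RLTerm × RLTerm) :=
  let x := RLTerm.var 0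
  let y := RLTerm.var 1
  let z := RLTerm.var 2
  let o := RLTerm.one
  let dist₁ (a b c : RLTerm) : RLTerm × RLTerm := (.inf a (.sup b c), .sup (.inf a b) (.inf a c))
  let dist₂ (a b c : RLTerm) : RLTerm × RLTerm := (.sup a (.inf b c), .inf (.sup a b) (.sup a c))
  {(.imp (.imp x o) o, x), dist₁ o y z, dist₁ x o z, dist₁ x y o, dist₂ o y z, dist₂ x o z,
    dist₂ x y o, (.inf (.mul x y) o, .mul (.inf x o) (.inf y o)),
    (.inf (.imp (.inf x o) y) (.imp (.inf (.imp y o) o) (.imp x o)), .imp x y)}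

/-- Equations that define `Ω(C)` among integral commutative residuated lattices -/
def eqOmega : Set (RLTerm × RLTerm) :=
  let x := RLTerm.var 0
  let y := RLTerm.var 1
  {(.sup (.imp x y) (.imp y x), .one), (.mul x (.imp x y), .mul y (.imp y x)),
    (.imp x (.mul x x), x)}

/-- The assignment of three values to the first three variables -/
def assign {A : Type u} (x y z : A) : ℕ → A
  | 0 => x
  | 1 => y
  | _ => z

theorem mem_KL_iff {A : CRLAlg.{u}} : A ∈ KL ↔ ∀ e ∈ eqKL, Sat A e := by
  constructor
  · rintro ⟨h₁, h₂, h₃, h₄⟩ e he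
    simp only [eqKL, Set.mem_insert_iff, Set.mem_singleton_iff] at he
    rcases he with rfl | rfl | rfl | rfl | rfl | rfl | rfl | rfl | rfl <;> intro v
    · exact h₁ _
    · exact (h₂ _ _ _ (Or.inl rfl)).1
    · exact (h₂ _ _ _ (Or.inr (Or.inl rfl))).1
    · exact (h₂ _ _ _ (Or.inr (Or.inr rfl))).1
    · exact (h₂ _ _ _ (Or.inl rfl)).2
    · exact (h₂ _ _ _ (Or.inr (Or.inl rfl))).2
    · exact (h₂ _ _ _ (Or.inr (Or.inr rfl))).2
    · exact h₃ _ _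
    · exact h₄ _ _
  · intro h
    simp only [eqKL, Set.forall_mem_insert, Set.mem_singleton_iff, forall_eq] at h
    obtain ⟨h₁, h₂, h₃, h₄, h₅, h₆, h₇, h₈, h₉⟩ := h
    refine ⟨fun x => h₁ (assign x x x), fun x y z h => ?_, fun x y => h₈ (assign x y x),
      fun x y => h₉ (assign x y x)⟩
    rcases h with rfl | rfl | rfl
    · exact ⟨h₂ (assign 1 y z), h₅ (assign 1 y z)⟩
    · exact ⟨h₃ (assign x 1 z), h₆ (assign x 1 z)⟩
    · exact ⟨h₄ (assign x y 1), h₇ (assign x y 1)⟩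

theorem mem_OmegaC_iff {L : CIRLAlg.{u}} : L ∈ OmegaC ↔ ∀ e ∈ eqOmega, Sat L e := by
  constructor
  · rintro ⟨⟨h₁, h₂⟩, h₃⟩ e he
    simp only [eqOmega, Set.mem_insert_iff, Set.mem_singleton_iff] at he
    rcases he with rfl | rfl | rfl <;> intro v
    · exact h₁ _ _
    · exact h₂ _ _
    · have := h₃ (v 0)
      rwa [sq] at this
  · intro h
    simp only [eqOmega, Set.forall_mem_insert, Set.mem_singleton_iff, forall_eq] at h
    obtain ⟨h₁, h₂, h₃⟩ := h
    refine ⟨⟨fun x y => h₁ (assign x y x), fun x y => h₂ (assign x y x)⟩, fun x => ?_⟩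
    rw [sq]
    exact h₃ (assign x x x)

theorem IsOmega.of_mem {L : CIRLAlg.{u}} (hL : L ∈ OmegaC) : IsOmega L := ⟨hL.1.2, hL.2⟩

theorem mem_OmegaC_of_chain (C : Type u) [LinearOrder C] [CommMonoid C] [Residuated C]
    [Integral C] [IsOmega C] : CIRLAlg.mk C ∈ OmegaC := by
  refine ⟨⟨fun x y => ?_, divisible⟩, himp_sq⟩
  rw [← Residuated.one_le]
  rcases le_total x y with h | h
  · exact (one_le_res.2 h).trans le_sup_left
  · exact (one_le_res.2 h).trans le_sup_right

theorem KExp_mem_KClass {L : CIRLAlg.{u}} {V : Set CIRLAlg.{u}} (hL : L ∈ V) :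
    CRLAlg.mk (KExp L) ∈ KClass V :=
  ⟨KExp.mem_KL, L, hL, id, Function.injective_id, ⟨fun _ _ => rfl, fun _ _ => rfl,
    fun _ _ => rfl, fun _ _ => rfl, rfl⟩⟩

theorem cone_mem_OmegaC {A : CRLAlg.{u}} (hA : A ∈ KClass OmegaC.{u}) :
    CIRLAlg.mk (Cone A) ∈ OmegaC := by
  obtain ⟨-, L, hL, f, hinj, hf⟩ := hA
  rw [mem_OmegaC_iff]
  intro e he
  exact (sat_coneEq e).1 (((sat_cone_KExp e).2 (mem_OmegaC_iff.1 hL e he)).of_injective hf hinj)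

/-- The defining equations are those of K-lattices together with the equations of Ω(C) relativized
to the negative cone; the cone itself then serves as the required L. -/
theorem isVariety_KClass_OmegaC : IsVariety (KClass OmegaC.{u}) := by
  refine ⟨eqKL ∪ coneEq '' eqOmega, Set.ext fun A => ⟨fun hA e he => ?_, fun h => ?_⟩⟩
  · rcases he with he | ⟨e, he, rfl⟩
    · exact mem_KL_iff.1 hA.1 e he
    · exact (sat_coneEq e).2 (mem_OmegaC_iff.1 (cone_mem_OmegaC hA) e he)
  · have hKL : A ∈ KL := mem_KL_iff.2 fun e he => h e (Or.inl he)
    exact ⟨hKL, CIRLAlg.mk (Cone A), mem_OmegaC_iff.2 fun e he =>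
      (sat_coneEq e).1 (h _ (Or.inr ⟨e, he, rfl⟩)), toKExp, toKExp_injective hKL,
      isHom_toKExp hKL⟩

/-! ### The algebras `K_ω^k` inside a variety -/

/-- An equation that fails in a member `A` of `K(Ω(C))` fails in some `K_ω^k` that belongs to the
variety generated by `A`. -/
theorem exists_KOmega_refutation {A : CRLAlg.{u}} (hA : A ∈ KClass OmegaC.{u})
    {e : RLTerm × RLTerm} (he : ¬ Satisfies A e) :
    ∃ k, ¬ Satisfies (KOmega k) e ∧ KOmega k ∈ varietyGen.{0, u} {A} := by
  have hL := cone_mem_OmegaC hA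
  have : IsOmega (Cone A) := IsOmega.of_mem hL
  have hK : ¬ Sat (KExp (Cone A)) e := fun h =>
    he (h.of_injective (isHom_toKExp hA.1) (toKExp_injective hA.1))
  obtain ⟨s, t, himp, x, hx⟩ : ∃ s t, (∀ k, Sat (KExp (OrdSum (Fin (k + 1)) COmega)) e →
      Sat (OrdSum (Fin (k + 1)) COmega) (s, t)) ∧ ∃ x : ℕ → Cone A, s.eval x ≠ t.eval x := by
    rw [KExp.sat_iff, not_and_or] at hK
    rcases hK with hK | hK
    · exact ⟨_, _, fun k h => ((KExp.sat_iff e).1 h).1, not_forall.1 hK⟩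
    · exact ⟨_, _, fun k h => ((KExp.sat_iff e).1 h).2, not_forall.1 hK⟩
  obtain ⟨F, hF⟩ := exists_primeFilter_separating hL.1.1 hx
  rw [PrimeFilter.isHom_proj.map_eval, PrimeFilter.isHom_proj.map_eval] at hF
  obtain ⟨k, ⟨g, hinj, hg⟩, y, hy⟩ := exists_ordSum_refutation _ s t hF
  refine ⟨k, fun h => hy (himp k h y), fun e' he' => ?_⟩
  -- `toKExp` need not be onto, but its composite with the projection to the K-expansion of a chain
  -- is. Hence that K-expansion is a quotient of A.
  have h₁ : Sat (KExp F.Chain) e' := Sat.of_surjective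
    ((KExp.isHom_map PrimeFilter.isHom_proj).comp (isHom_toKExp hA.1))
    (map_toKExp_surjective hA.1 PrimeFilter.isHom_proj PrimeFilter.proj_surjective) (he' A rfl)
  exact h₁.of_injective (KExp.isHom_map hg) (KExp.map_injective hinj)

/-- An order embedding of the index sets induces an embedding of the ordinal sums. -/
theorem exists_ordSum_embedding {I : Type u} {J : Type v} [LinearOrder I] [LinearOrder J]
    {f : I → J} (hf : StrictMono f) :
    ∃ g : OrdSum I COmega → OrdSum J COmega, Function.Injective g ∧ IsHom g := by
  have h : (⟨1⟩ : COmega) < 1 := COmega.lt_one one_ne_zero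
  refine exists_embedding (fun i => .el (f i) ⟨1⟩ h) (fun i => OrdSum.el_ne_one _ _ _)
    fun i j hij => ⟨OrdSum.el_ne_one _ _ _, OrdSum.el_ne_one _ _ _, ?_⟩
  rw [OrdSum.el_mul_el, if_pos (hf hij)]

theorem sat_KExp_ordSum_of_strictMono {I : Type u} {J : Type v} [LinearOrder I] [LinearOrder J]
    {f : I → J} (hf : StrictMono f) {e : RLTerm × RLTerm} (h : Sat (KExp (OrdSum J COmega)) e) :
    Sat (KExp (OrdSum I COmega)) e := by
  obtain ⟨g, hinj, hg⟩ := exists_ordSum_embedding hf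
  exact h.of_injective (KExp.isHom_map hg) (KExp.map_injective hinj)

theorem satisfies_KOmega_of_le {k l : ℕ} (h : l ≤ k) {e : RLTerm × RLTerm}
    (he : Satisfies (KOmega k) e) : Satisfies (KOmega l) e :=
  sat_KExp_ordSum_of_strictMono (Fin.strictMono_castLE (Nat.succ_le_succ h)) he

/-- A copy of `K_ω^k` in an arbitrary universe -/
noncomputable def KOmegaLift (k : ℕ) : CRLAlg.{u} where
  carrier := KExp (OrdSum (ULift.{u} (Fin (k + 1))) COmega)

/-- Only varieties in universe 0 can contain `KOmega k` itself; the lifted copy stands in for it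
elsewhere. -/
theorem satisfies_KOmegaLift {k : ℕ} {e : RLTerm × RLTerm} :
    Satisfies (KOmegaLift.{u} k) e ↔ Satisfies (KOmega k) e :=
  ⟨fun h => sat_KExp_ordSum_of_strictMono (f := ULift.up) (fun _ _ h => h) h,
    fun h => sat_KExp_ordSum_of_strictMono (f := ULift.down) (fun _ _ h => h) h⟩

theorem KOmegaLift_mem_KClass (k : ℕ) : KOmegaLift.{u} k ∈ KClass OmegaC.{u} :=
  KExp_mem_KClass (mem_OmegaC_of_chain _)

theorem nontrivial_KOmegaLift (k : ℕ) : Nontrivial (KOmegaLift.{u} k) := by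
  refine ⟨⟨1, .el ⟨0⟩ ⟨1⟩ (COmega.lt_one one_ne_zero)⟩, ⟨1, 1⟩, fun h => ?_⟩
  exact OrdSum.el_ne_one _ _ _ (congrArg KExp.snd h)

/-! ### The number of components -/

/-- The meet of the terms `(xᵢ₊₁ → xᵢ) → xᵢ` for `i < n` -/
def linkTerm : ℕ → RLTerm
  | 0 => .one
  | n + 1 => .inf (linkTerm n) (.imp (.imp (.var (n + 1)) (.var n)) (.var n))

/-- The join of the variables `xᵢ` for `i ≤ n` -/
def joinTerm : ℕ → RLTerm
  | 0 => .var 0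
  | n + 1 => .sup (joinTerm n) (.var (n + 1))

/-- In chains of `Ω(C)` this equation says that there are at most `n` components. -/
def depthEq (n : ℕ) : RLTerm × RLTerm := (.imp (linkTerm n) (joinTerm n), .one)

section Depth

variable {C : Type u} [LinearOrder C] [CommMonoid C] [Residuated C] [Integral C] [IsOmega C]

theorem joinTerm_ne_one {x : ℕ → C} : ∀ n : ℕ,
    (joinTerm n).eval x ≠ 1 ↔ ∀ i ≤ n, x i ≠ 1
  | 0 => by simp [joinTerm, RLTerm.eval]
  | n + 1 => by
    have h : ∀ a b : C, a ⊔ b ≠ 1 ↔ a ≠ 1 ∧ b ≠ 1 := fun a b => by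
      rcases le_total a b with h | h
      · rw [sup_eq_right.2 h, iff_and_self]
        rintro hb rfl
        exact hb (Residuated.one_le.1 h)
      · rw [sup_eq_left.2 h, iff_self_and]
        rintro ha rfl
        exact ha (Residuated.one_le.1 h)
    simp only [joinTerm, RLTerm.eval, h, joinTerm_ne_one n, Nat.le_succ_iff]
    constructor
    · rintro ⟨h₁, h₂⟩ i (hi | rfl)
      exacts [h₁ i hi, h₂]
    · exact fun h => ⟨fun i hi => h i (Or.inl hi), h _ (Or.inr rfl)⟩

theorem le_joinTerm {x : ℕ → C} : ∀ n i : ℕ, i ≤ n → x i ≤ (joinTerm n).eval x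
  | 0, i, h => by rw [Nat.le_zero.1 h]; exact le_rfl
  | n + 1, i, h => by
    rcases Nat.le_succ_iff.1 h with h | rfl
    · exact (le_joinTerm n i h).trans le_sup_left
    · exact le_sup_right

theorem linkTerm_eq_one {x : ℕ → C} : ∀ n : ℕ, (∀ i < n, Below (x i) (x (i + 1))) →
    (linkTerm n).eval x = 1
  | 0, _ => rfl
  | n + 1, h => by
    simp only [linkTerm, RLTerm.eval]
    rw [linkTerm_eq_one n fun i hi => h i (hi.trans n.lt_succ_self),
      res_eq_of_mul_eq (h n n.lt_succ_self).2.2, res_self, inf_idem]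

/-- For b ≤ a the left side is a. For a < b put v = b → a; then vb = a = v(v → a), and cancelling v
gives v → a = b. -/
theorem res_res_le_sup {a b : C} (ha : a ≠ 1) (hab : a * b ≠ a) : (b ⇨ a) ⇨ a ≤ a ⊔ b := by
  rcases le_or_gt b a with h | h
  · rw [res_eq_one.2 h, one_res]
    exact le_sup_left
  · have hv : b ⇨ a ≠ 1 := fun e => h.not_ge (res_eq_one.1 e)
    have h₁ : (b ⇨ a) * b = a := by rw [mul_comm, mul_res_of_le h.le]
    have h₂ : (b ⇨ a) * ((b ⇨ a) ⇨ a) = a := mul_res_of_le (le_res b a)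
    have h₃ : a ≠ b ⇨ a := fun e => hab (mul_eq_of_res_eq ha e.symm)
    rw [eq_of_mul_eq hv (h₂.trans h₁.symm) (h₂.symm ▸ h₃)]
    exact le_sup_right

theorem linkTerm_le {x : ℕ → C} : ∀ n i : ℕ, i < n → (∀ i ≤ n, x i ≠ 1) →
    ¬ Below (x i) (x (i + 1)) → (linkTerm n).eval x ≤ x i ⊔ x (i + 1)
  | 0, i, h, _, _ => absurd h i.not_lt_zero
  | n + 1, i, h, hx, hb => by
    simp only [linkTerm, RLTerm.eval]
    rcases Nat.lt_succ_iff_lt_or_eq.1 h with h | rfl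
    · exact inf_le_left.trans (linkTerm_le n i h (fun j hj => hx j (hj.trans n.le_succ)) hb)
    · exact inf_le_right.trans (res_res_le_sup (hx i (Nat.le_succ i)) fun h =>
        hb ⟨hx i (Nat.le_succ i), hx (i + 1) le_rfl, h⟩)

/-- A strict rise between components makes its conjunct of the link term a → a = 1. A missing rise
between non-units pushes the link term below the join, by `res_res_le_sup`, so the equation holds.
-/
theorem depthEq_fails_iff {n : ℕ} {x : ℕ → C} :
    (depthEq n).1.eval x ≠ (depthEq n).2.eval x ↔
      (∀ i ≤ n, x i ≠ 1) ∧ ∀ i < n, Below (x i) (x (i + 1)) := by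
  change (linkTerm n).eval x ⇨ (joinTerm n).eval x ≠ 1 ↔ _
  constructor
  · intro h
    have hx : ∀ i ≤ n, x i ≠ 1 := by
      rw [← joinTerm_ne_one]
      intro e
      rw [e, res_one] at h
      exact h rfl
    refine ⟨hx, fun i hi => ?_⟩
    by_contra hb
    exact h (res_eq_one.2 ((linkTerm_le n i hi hx hb).trans
      (sup_le (le_joinTerm n i hi.le) (le_joinTerm n (i + 1) hi))))
  · rintro ⟨hx, hb⟩
    rw [linkTerm_eq_one n hb, one_res]
    exact (joinTerm_ne_one n).2 hx

end Depth

theorem not_satisfies_depthEq (n : ℕ) : ¬ Satisfies (KOmega n) (coneEq (depthEq n)) := by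
  intro h
  have h := (sat_cone_KExp _).1 (show Sat (KExp (OrdSum (Fin (n + 1)) COmega)) _ from h)
  have h₁ : (⟨1⟩ : COmega) < 1 := COmega.lt_one one_ne_zero
  let x : ℕ → OrdSum (Fin (n + 1)) COmega := fun i => .el (Fin.ofNat (n + 1) i) ⟨1⟩ h₁
  refine depthEq_fails_iff.2 ⟨fun i _ => OrdSum.el_ne_one _ _ _, fun i hi =>
    ⟨OrdSum.el_ne_one _ _ _, OrdSum.el_ne_one _ _ _, ?_⟩⟩ (h x)
  refine (OrdSum.el_mul_el _ _ _ _ _ _).trans (if_pos ?_)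
  rw [Fin.lt_def, Fin.val_ofNat, Fin.val_ofNat, Nat.mod_eq_of_lt (by omega),
    Nat.mod_eq_of_lt (by omega)]
  exact i.lt_succ_self

theorem satisfies_depthEq {k n : ℕ} (hk : k < n) : Satisfies (KOmega k) (coneEq (depthEq n)) := by
  refine (sat_cone_KExp (L := OrdSum (Fin (k + 1)) COmega) _).2 fun x => ?_
  by_contra h
  obtain ⟨hx, hb⟩ := depthEq_fails_iff.1 h
  -- Each rise strictly increases the index of the summand, so x i lies in a summand of index at
  -- least i. For i = n this needs more than the k + 1 available copies.
  have hidx : ∀ i ≤ n, ∃ (j : Fin (k + 1)) (a : COmega) (ha : a < 1), x i = .el j a ha ∧ i ≤ j := by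
    intro i
    induction i with
    | zero =>
      intro hi
      rcases hxi : x 0 with _ | ⟨j, a, ha⟩
      · exact absurd hxi (hx 0 hi)
      · exact ⟨j, a, ha, rfl, Nat.zero_le _⟩
    | succ i ih =>
      intro hi
      obtain ⟨j, a, ha, hxi, hij⟩ := ih (by omega)
      rcases hxi' : x (i + 1) with _ | ⟨l, b, hb'⟩
      · exact absurd hxi' (hx (i + 1) hi)
      · refine ⟨l, b, hb', rfl, ?_⟩
        have hbel := hb i hi
        rw [hxi, hxi'] at hbel
        have hlt := OrdSum.el_lt_el.1 hbel.lt
        rcases hlt with hjl | ⟨rfl, hab⟩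
        · exact lt_of_le_of_lt hij hjl
        · have := hbel.2.2
          rw [OrdSum.el_mul_el, if_neg (lt_irrefl _), if_neg (lt_irrefl _)] at this
          injection this with _ h₂
          have h₃ : a.exp + b.exp = a.exp := congrArg COmega.exp h₂
          exact absurd (by omega) (COmega.exp_ne_zero hb')
  obtain ⟨j, _, _, _, hj⟩ := hidx n le_rfl
  omega

/-! ### Subvarieties -/

/-- The indices `k` for which `K_ω^k` satisfies all equations of `W` -/
def indices (W : Set CRLAlg.{u}) : Set ℕ := {k | KOmega k ∈ varietyGen.{0, u} W}

/-- The variety generated by the algebras `K_ω^k` with `k ∈ D` -/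
def varietyOf (D : Set ℕ) : Set CRLAlg.{u} := varietyGen.{u, 0} (KOmega '' D)

theorem mem_varietyOf {D : Set ℕ} {A : CRLAlg.{u}} :
    A ∈ varietyOf D ↔ ∀ e, (∀ k ∈ D, Satisfies (KOmega k) e) → Satisfies A e := by
  simp [varietyOf, varietyGen]

theorem isVariety_varietyOf (D : Set ℕ) : IsVariety (varietyOf.{u} D) := isVariety_varietyGen _

theorem KOmegaLift_mem_varietyOf {D : Set ℕ} {k : ℕ} :
    KOmegaLift.{u} k ∈ varietyOf.{u} D ↔ ∃ l ∈ D, k ≤ l := by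
  rw [mem_varietyOf]
  constructor
  · intro h
    by_contra! hcon
    exact not_satisfies_depthEq k (satisfies_KOmegaLift.1 (h (coneEq (depthEq k)) fun l hl =>
      satisfies_depthEq (hcon l hl)))
  · rintro ⟨l, hl, hkl⟩ e he
    exact satisfies_KOmegaLift.2 (satisfies_KOmega_of_le hkl (he l hl))

theorem varietyOf_subset_KClass (D : Set ℕ) : varietyOf.{u} D ⊆ KClass OmegaC.{u} := by
  obtain ⟨E, hE⟩ := isVariety_KClass_OmegaC.{u}
  intro A hA
  rw [hE]
  refine fun e he => mem_varietyOf.1 hA e fun k _ => satisfies_KOmegaLift.{u}.1 ?_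
  have := KOmegaLift_mem_KClass.{u} k
  rw [hE] at this
  exact this e he

/-- If an equation holds in all K_ω^k with k in the index set but fails in A ∈ W, then it fails in
some K_ω^k in V(A), whose index belongs to the set. -/
theorem eq_varietyOf_indices {W : Set CRLAlg.{u}} (hW : IsVariety W)
    (hsub : W ⊆ KClass OmegaC.{u}) : W = varietyOf (indices W) := by
  apply Set.Subset.antisymm
  · intro A hA
    rw [mem_varietyOf]
    intro e he
    by_contra hcon
    obtain ⟨k, hk, hkA⟩ := exists_KOmega_refutation (hsub hA) hcon
    exact hk (he k fun e' he' => hkA e' fun B hB => hB ▸ he' A hA)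
  · obtain ⟨E, rfl⟩ := hW
    intro A hA e he
    exact mem_varietyOf.1 hA e fun k hk => hk e fun B hB => hB e he

theorem indices_mono_left (W : Set CRLAlg.{u}) {k l : ℕ} (h : l ≤ k) (hk : k ∈ indices W) :
    l ∈ indices W := fun e he => satisfies_KOmega_of_le h (hk e he)

theorem exists_initial_segment {D : Set ℕ} (hD : ∀ k ∈ D, ∀ l ≤ k, l ∈ D) :
    ∃ n : WithTop ℕ, D = {k : ℕ | (k : WithTop ℕ) < n} := by
  by_cases h : ∃ n, n ∉ D
  · classical
    -- The bound is the least number missing from D.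
    refine ⟨(Nat.find h : ℕ), Set.ext fun k => ?_⟩
    rw [Set.mem_ofPred_eq, Nat.cast_lt, Nat.lt_find_iff]
    exact ⟨fun hk l hl => not_not.2 (hD k hk l hl), fun hk => not_not.1 (hk k le_rfl)⟩
  · push Not at h
    exact ⟨⊤, Set.ext fun k => ⟨fun _ => WithTop.coe_lt_top k, fun _ => h k⟩⟩

/-- The chain of subvarieties -/
def subvariety (n : WithTop ℕ) : Subvariety (KClass OmegaC.{u}) :=
  ⟨varietyOf {k : ℕ | (k : WithTop ℕ) < n}, isVariety_varietyOf _, varietyOf_subset_KClass _⟩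

theorem KOmegaLift_mem_subvariety {n : WithTop ℕ} {k : ℕ} :
    KOmegaLift.{u} k ∈ (subvariety.{u} n).1 ↔ (k : WithTop ℕ) < n :=
  KOmegaLift_mem_varietyOf.trans
    ⟨fun ⟨_, hl, hkl⟩ => lt_of_le_of_lt (WithTop.coe_le_coe.2 hkl) hl, fun h => ⟨k, h, le_rfl⟩⟩

theorem subvariety_le_iff {m n : WithTop ℕ} : subvariety.{u} m ≤ subvariety.{u} n ↔ m ≤ n := by
  constructor
  · intro h
    by_contra! hlt
    obtain ⟨k, rfl⟩ := WithTop.ne_top_iff_exists.1 (hlt.trans_le le_top).ne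
    exact lt_irrefl _ (KOmegaLift_mem_subvariety.1 (h (KOmegaLift_mem_subvariety.2 hlt)))
  · intro h A hA
    exact mem_varietyOf.2 fun e he => mem_varietyOf.1 hA e fun k hk => he k (lt_of_lt_of_le hk h)

theorem subvariety_surjective : Function.Surjective subvariety.{u} := by
  rintro ⟨W, hW, hsub⟩
  obtain ⟨n, hn⟩ := exists_initial_segment fun k hk l hl => indices_mono_left W hl hk
  refine ⟨n, Subtype.ext ?_⟩
  exact (congrArg varietyOf hn).symm.trans (eq_varietyOf_indices hW hsub).symm

/-- The lattice of subvarieties of `K(Ω(C))` -/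
noncomputable def subvarietyOrderIso : WithTop ℕ ≃o Subvariety (KClass OmegaC.{u}) :=
  RelIso.ofSurjective (OrderEmbedding.ofMapLEIff subvariety fun _ _ => subvariety_le_iff)
    subvariety_surjective

theorem subvariety_top : (subvariety.{u} ⊤).1 = KClass OmegaC.{u} := by
  obtain ⟨n, hn⟩ := subvariety_surjective ⟨KClass OmegaC.{u}, isVariety_KClass_OmegaC, subset_rfl⟩
  apply Set.Subset.antisymm (subvariety ⊤).2.2
  have : subvariety n ≤ subvariety ⊤ := subvariety_le_iff.2 le_top
  rwa [hn] at this

theorem exists_nontrivial_mem_subvariety {n : WithTop ℕ} :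
    (∃ A ∈ (subvariety.{u} n).1, Nontrivial A) ↔ n ≠ 0 := by
  constructor
  · rintro ⟨A, hA, a, b, hab⟩ rfl
    -- With no generators, the equation between two distinct variables holds vacuously.
    exact hab (mem_varietyOf.1 hA (.var 0, .var 1) (fun k hk => absurd hk (not_lt_bot (α := WithTop ℕ)))
      (assign a b b))
  · intro hn
    exact ⟨KOmegaLift 0, KOmegaLift_mem_subvariety.2 (bot_lt_iff_ne_bot.2 hn),
      nontrivial_KOmegaLift 0⟩

/-- The generators with l ≤ k embed into K_ω^k, so the last one suffices. The shift by one leaves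
position 0 to the trivial variety. -/
theorem subvariety_succ (k : ℕ) :
    (subvariety.{u} ((k + 1 : ℕ) : WithTop ℕ)).1 = varietyGen.{u, 0} {KOmega k} := by
  ext A
  refine mem_varietyOf.trans ⟨fun h e he => h e fun l hl => ?_, fun h e he => h e ?_⟩
  · exact satisfies_KOmega_of_le (Nat.lt_succ_iff.1 (WithTop.coe_lt_coe.1 hl)) (he _ rfl)
  · rintro B rfl
    exact he k (WithTop.coe_lt_coe.2 k.lt_succ_self)

end KLattice

/-! ### Main theorem -/

/-- `WithTop ℕ` is the chain of order type `ω + 1`; a variety is nontrivial if it has a member with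
more than one element. -/
theorem mainTheorem12 :
    KLattice.IsVariety (KLattice.KClass KLattice.OmegaC.{u}) ∧
    Nonempty (KLattice.Subvariety (KLattice.KClass KLattice.OmegaC.{u}) ≃o WithTop ℕ) ∧
    ∀ W : Set KLattice.CRLAlg.{u},
      (KLattice.IsVariety W ∧ W ⊂ KLattice.KClass KLattice.OmegaC.{u} ∧
          ∃ A ∈ W, Nontrivial A) ↔
        ∃ k : ℕ, W = KLattice.varietyGen {KLattice.KOmega k} := by
  refine ⟨KLattice.isVariety_KClass_OmegaC, ⟨KLattice.subvarietyOrderIso.symm⟩, fun W => ?_⟩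
  constructor
  · rintro ⟨hW, hsub, hnt⟩
    obtain ⟨n, hn⟩ := KLattice.subvariety_surjective ⟨W, hW, hsub.subset⟩
    obtain rfl : (KLattice.subvariety n).1 = W := congrArg Subtype.val hn
    have hn₀ := KLattice.exists_nontrivial_mem_subvariety.1 hnt
    induction n with
    | top => exact absurd KLattice.subvariety_top hsub.ne
    | coe n =>
      obtain _ | k := n
      · exact absurd rfl hn₀
      · exact ⟨k, KLattice.subvariety_succ k⟩
  · rintro ⟨k, rfl⟩
    rw [← KLattice.subvariety_succ]
    refine ⟨(KLattice.subvariety _).2.1, ⟨(KLattice.subvariety _).2.2, fun h => ?_⟩,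
      KLattice.exists_nontrivial_mem_subvariety.2 (Nat.cast_ne_zero.2 k.succ_ne_zero)⟩
    -- Properness: K_ω^(k+1) belongs to K(Ω(C)) but not to the variety generated by K_ω^k.
    exact lt_irrefl _ (KLattice.KOmegaLift_mem_subvariety.1
      (h (KLattice.KOmegaLift_mem_KClass (k + 1))))
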